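/- **The problem.** An election has parties $C=\{c_1,\dots,c_m\}$ and $n\ge 1$ voters with preference orders (rankings of $C$) $\mathcal O=(O_1,\dots,O_n)$. For a profile $\mathcal O$ let $s_{\mathcal O}(c)$ be the number of orders in which $c$ is first (Plurality). For a threshold $t\in[0,1]$, party $c$ is *active* under $\mathcal O$ if $s_{\mathcal O}(c)\ge t\,n$; its fraction of seats $\sigma_{\mathcal O}(c)$ is $s_{\mathcal O}(c)/\sum_{c'\text{ active}}s_{\mathcal O}(c')$ if $c$ is active and $0$ otherwise, and $\sigma_{\mathcal O}(S)=\sum_{c\in S}\sigma_{\mathcal O}(c)$. An instance of Plurality$_t$-CBP with $\$$-bribery consists of an election, a coalition $A\subseteq C$, a preferred party in $A$ (called $c_1$ below), prices $p_1,\dots,p_n\ge 0$ of the voters, a budget $B\ge 0$, a threshold $t$, a target support $\varphi$ and a target ratio $\rho$, where $t,\varphi,\rho\in[0,1]$ and all these numbers are rational. The question is whether there is a profile $\hat{\mathcal O}=(\hat O_1,\dots,\hat O_n)$ with (a) $\sum_{i:\hat O_i\ne O_i}p_i\le B$, (b) $\sigma_{\hat{\mathcal O}}(A)\ge\varphi\,\sigma_{\hat{\mathcal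 O}}(C)$, and (c) $\sigma_{\hat{\mathcal O}}(c_1)\ge\rho\,\sigma_{\hat{\mathcal O}}(A)$. **The algorithm.** Let $V_j$ be the set of voters whose first party is $c_j$, $A_{-1}=A\setminus\{c_1\}$ and $\bar A=C\setminus A$. Let $\mathrm{mincost}(c_j,\ell)$ be the sum of the $\ell$ least prices of voters in $V_j$ ($\infty$ if $\ell>|V_j|$). Put $f(\{c_j\},\ell,a)=\mathrm{mincost}(c_j,\ell)$ if $a=|V_j|-\ell\ge tn$, or if $|V_j|-\ell<tn$ and $a=0$; and $h(\{c_j\},\ell,d,a)=\mathrm{mincost}(c_j,\ell)$ if $a=|V_j|-\ell+d\ge tn$, or if $|V_j|-\ell+d<tn$ and $a=0$; in all other cases the value is $\infty$. Put $f(\emptyset,0,0)=h(\emptyset,0,0,0)=0$, with value $\infty$ at all other arguments of $\emptyset$, and, adding the parties one by one, $$f(D\cup\{c_j\},\ell,a)=\min_{\ell'\le\ell,\ a'\le a}\bigl(f(D,\ell',a')+f(\{c_j\},\ell-\ell',a-a')\bigr),$$ $$h(D\cup\{c_j\},\ell,d,a)=\min_{\ell'\le\ell,\ d'\le d,\ a'\le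 a}\bigl(h(D,\ell',d',a')+h(\{c_j\},\ell-\ell',d-d',a-a')\bigr),$$ $$g(\ell,b,d,a)=\min_{\ell'\le\ell}\bigl(h(A_{-1},\ell',d,a)+f(\bar A,\ell-\ell',b)\bigr).$$ The algorithm runs over all $0\le\ell,b,d,a\le n$. It answers "yes" if for some of them $g(\ell,b,d,a)\le B$; if $d>\ell$, also $g(\ell,b,d,a)+\mathrm{mincost}(c_1,d-\ell)\le B$; and, with $a_1=|V_1|+\ell-d$, replaced by $0$ if it is less than $tn$, both $a+a_1\ge\varphi\,(a+a_1+b)$ and $a_1\ge\rho\,(a+a_1)$. Otherwise it answers "no". **Theorem.** On every instance the algorithm answers "yes" if and only if the answer to Plurality$_t$-CBP with $\$$-bribery is yes, and its answer is computable in time polynomial in the length of the instance, with all numbers written in binary (on a random access machine with logarithmic cost). In particular, Plurality$_t$-CBP with $\$$-bribery is solvable in polynomial time. -/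

import Mathlib

namespace CoalitionBribery

/-! ### Parliamentary elections and seat allocation -/

/-- A preference order (ranking) of the `m` parties; `O c` is the rank of party `c`,
counted from `0` for the most preferred party. -/
abbrev PrefOrder (m : ℕ) := Equiv.Perm (Fin m)

/-- The position `pos(O, c) ∈ {1, …, m}` of a party. -/
def pos {m : ℕ} (O : PrefOrder m) (c : Fin m) : ℕ := (O c : ℕ) + 1

/-- The Plurality scoring function. -/
def plurality {m : ℕ} (O : PrefOrder m) (c : Fin m) : ℕ := if pos O c = 1 then 1 else 0

section Seats

variable {m n : ℕ} (γ : PrefOrder m → Fin m → ℕ) (t : ℚ≥0) (P : Fin n → PrefOrder m)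

/-- Points `γ(𝒪, C')` given by a profile of orders to a set of parties. -/
def points (S : Finset (Fin m)) : ℕ := ∑ i, ∑ c ∈ S, γ (P i) c

/-- A party is inactive if it gets less than a `t` fraction of all the points. -/
def IsActive (c : Fin m) : Prop :=
  ¬ ((points γ P {c} : ℚ≥0) < t * (points γ P Finset.univ : ℚ≥0))

instance (c : Fin m) : Decidable (IsActive γ t P c) :=
  inferInstanceAs (Decidable (¬ _))

/-- The fraction of seats of a party, with min-size threshold `t`. -/
def seats (c : Fin m) : ℚ≥0 :=
  if IsActive γ t P c then
    (points γ P {c} : ℚ≥0) / ∑ c' with IsActive γ t P c', (points γ P {c'} : ℚ≥0)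
  else 0

/-- The fraction of seats of a set of parties. -/
def seatsOf (S : Finset (Fin m)) : ℚ≥0 := ∑ c ∈ S, seats γ t P c

end Seats

/-! ### The decision problem -/

/-- An instance of the Coalition-Bribery-with-Preferred-party problem under `$`-bribery. -/
structure Instance where
  /-- number of parties -/
  m : ℕ
  /-- number of voters -/
  n : ℕ
  n_pos : 0 < n
  /-- the preference orders of the voters -/
  order : Fin n → PrefOrder m
  /-- the coalition `A` -/
  coalition : Finset (Fin m)
  /-- the preferred party `c₁` -/
  preferred : Fin m
  preferred_mem : preferred ∈ coalition
  /-- the price `pᵢ` of each voter -/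
  price : Fin n → ℚ≥0
  /-- the budget `B` -/
  budget : ℚ≥0
  /-- the min-size threshold `t` -/
  threshold : ℚ≥0
  threshold_le : threshold ≤ 1
  /-- the target support `φ` -/
  support : ℚ≥0
  support_le : support ≤ 1
  /-- the target ratio `ρ` -/
  ratio : ℚ≥0
  ratio_le : ratio ≤ 1

namespace Instance

variable (I : Instance)

/-- The cost of a `$`-bribe: the price of every voter whose order is changed. -/
def bribeCost (P : Fin I.n → PrefOrder I.m) : ℚ≥0 :=
  ∑ i, if P i = I.order i then 0 else I.price i

/-- The question of Plurality`_t`-CBP with `$`-bribery: is there a bribe `P` within the budget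
such that the coalition reaches the target support and the preferred party the target ratio? -/
def IsYes : Prop :=
  ∃ P : Fin I.n → PrefOrder I.m,
    I.bribeCost P ≤ I.budget ∧
    I.support * seatsOf plurality I.threshold P Finset.univ
      ≤ seatsOf plurality I.threshold P I.coalition ∧
    I.ratio * seatsOf plurality I.threshold P I.coalition
      ≤ seats plurality I.threshold P I.preferred

/-! ### The dynamic program

Costs take values in `WithTop ℚ≥0`, where `⊤` means that no suitable undetermined bribe exists. -/

/-- `V_c`: the voters whose top party is `c`. -/
def supporters (c : Fin I.m) : Finset (Fin I.n) := {i | pos (I.order i) c = 1}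

/-- The number of votes from which on a party is active. -/
def quota : ℚ≥0 := I.threshold * (I.n : ℚ≥0)

/-- The least cost of bribing `l` supporters of `c`: the sum of the `l` least prices. -/
def mincost (c : Fin I.m) (l : ℕ) : WithTop ℚ≥0 :=
  if l ≤ (I.supporters c).card then
    ((((((I.supporters c).val.map I.price).sort (· ≤ ·)).take l).sum : ℚ≥0) : WithTop ℚ≥0)
  else ⊤

/-- `f({c}, l, a)` for a single party. -/
def fOne (c : Fin I.m) (l a : ℕ) : WithTop ℚ≥0 :=
  let v := (I.supporters c).card - l
  if (I.quota ≤ (v : ℚ≥0) ∧ a = v) ∨ ((v : ℚ≥0) < I.quota ∧ a = 0) then I.mincost c l else ⊤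

/-- `f(D, l, a)`: the least cost of bribing `l` supporters of parties in `D` so that exactly `a`
votes of the others among these supporters are active. -/
def f : List (Fin I.m) → ℕ → ℕ → WithTop ℚ≥0
  | [], l, a => if l = 0 ∧ a = 0 then 0 else ⊤
  | c :: D, l, a =>
    (Finset.range (l + 1)).inf fun l' => (Finset.range (a + 1)).inf fun a' =>
      f D l' a' + I.fOne c (l - l') (a - a')

/-- `h({c}, l, d, a)` for a single party. -/
def hOne (c : Fin I.m) (l d a : ℕ) : WithTop ℚ≥0 :=
  let v := (I.supporters c).card - l + d
  if (I.quota ≤ (v : ℚ≥0) ∧ a = v) ∨ ((v : ℚ≥0) < I.quota ∧ a = 0) then I.mincost c l else ⊤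

/-- `h(D, l, d, a)`: the least cost of bribing `l` supporters of parties in `D` so that with `d`
additional votes for parties in `D` a total of exactly `a` active votes for `D` is possible. -/
def h : List (Fin I.m) → ℕ → ℕ → ℕ → WithTop ℚ≥0
  | [], l, d, a => if l = 0 ∧ d = 0 ∧ a = 0 then 0 else ⊤
  | c :: D, l, d, a =>
    (Finset.range (l + 1)).inf fun l' => (Finset.range (d + 1)).inf fun d' =>
      (Finset.range (a + 1)).inf fun a' =>
        h D l' d' a' + I.hOne c (l - l') (d - d') (a - a')

/-- The parties outside the coalition. -/
def outsiders : List (Fin I.m) := (I.coalitionᶜ).sort (· ≤ ·)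

/-- The coalition without the preferred party. -/
def partners : List (Fin I.m) := (I.coalition.erase I.preferred).sort (· ≤ ·)

/-- `g(l, b, d, a)`: the least cost of an undetermined bribe of `l` voters, none of them a
supporter of the preferred party, that leaves exactly `b` active votes for the outsiders and
allows `a` active votes for the partners when `d` votes are added to the partners. -/
def g (l b d a : ℕ) : WithTop ℚ≥0 :=
  (Finset.range (l + 1)).inf fun l' => I.h I.partners l' d a + I.f I.outsiders (l - l') b

/-- The body of the main loop: does the iteration `(l, b, d, a)` report success?
The two target tests are written without denominators, as in the question `IsYes`. -/
def succeeds (l b d a : ℕ) : Bool :=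
  let x := (I.supporters I.preferred).card + l - d
  let a₁ := if (x : ℚ≥0) < I.quota then 0 else x
  decide (I.g l b d a ≤ I.budget) &&
  decide (l < d → I.g l b d a + I.mincost I.preferred (d - l) ≤ I.budget) &&
  decide (I.support * ((a + a₁ + b : ℕ) : ℚ≥0) ≤ ((a + a₁ : ℕ) : ℚ≥0)) &&
  decide (I.ratio * ((a + a₁ : ℕ) : ℚ≥0) ≤ (a₁ : ℚ≥0))

/-- The algorithm: try all `0 ≤ l, b, d, a ≤ n`. -/
def algorithm : Bool :=
  (List.range (I.n + 1)).any fun l => (List.range (I.n + 1)).any fun b =>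
    (List.range (I.n + 1)).any fun d => (List.range (I.n + 1)).any fun a => I.succeeds l b d a

/-! ### The input to a machine -/

/-- The numerator and the denominator of a rational number in lowest terms. -/
def encodeRat (q : ℚ≥0) : List ℕ := [q.num, q.den]

/-- An instance written as a list of natural numbers: the numbers of parties and voters, every
ballot as the list of the parties from the first to the last position, the coalition as a
0/1-vector, the preferred party, the prices, the budget, and the three fractions. -/
def encode : List ℕ :=
  [I.m, I.n] ++
  (List.finRange I.n).flatMap
    (fun i => (List.finRange I.m).map fun k => (((I.order i).symm k : Fin I.m) : ℕ)) ++
  (List.finRange I.m).map (fun c => if c ∈ I.coalition then 1 else 0) ++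
  [(I.preferred : ℕ)] ++
  (List.finRange I.n).flatMap (fun i => encodeRat (I.price i)) ++
  encodeRat I.budget ++ encodeRat I.threshold ++ encodeRat I.support ++ encodeRat I.ratio

end Instance

/-! ### Polynomial time

Programs for a random access machine with logarithmic cost: structured programs over finitely many
arrays of natural numbers, where every operation costs at least the bit lengths of the addresses
and of the numbers that it reads and produces. -/

/-- The memory: `s a i` is cell `i` of array `a`. -/
abbrev Memory := ℕ → ℕ → ℕ

/-- Expressions; `sub` is truncated subtraction. -/
inductive Expr where
  | const (k : ℕ)
  | read (a : ℕ) (i : Expr)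
  | add (e₁ e₂ : Expr)
  | sub (e₁ e₂ : Expr)
  | mul (e₁ e₂ : Expr)

namespace Expr

/-- The value of an expression. -/
def eval (s : Memory) : Expr → ℕ
  | const k => k
  | read a i => s a (i.eval s)
  | add e₁ e₂ => e₁.eval s + e₂.eval s
  | sub e₁ e₂ => e₁.eval s - e₂.eval s
  | mul e₁ e₂ => e₁.eval s * e₂.eval s

/-- The time to evaluate an expression: every node costs the bit length of its value plus one. -/
def cost (s : Memory) : Expr → ℕ
  | const k => Nat.size k + 1
  | read a i => i.cost s + Nat.size (s a (i.eval s)) + 1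
  | add e₁ e₂ => e₁.cost s + e₂.cost s + Nat.size (e₁.eval s + e₂.eval s) + 1
  | sub e₁ e₂ => e₁.cost s + e₂.cost s + Nat.size (e₁.eval s - e₂.eval s) + 1
  | mul e₁ e₂ => e₁.cost s + e₂.cost s + Nat.size (e₁.eval s * e₂.eval s) + 1

end Expr

/-- Programs; a test `e` succeeds if its value is not zero. -/
inductive Program where
  | skip
  | write (a : ℕ) (i e : Expr)
  | seq (p q : Program)
  | ite (e : Expr) (p q : Program)
  | loop (e : Expr) (p : Program)

/-- Store the value `v` in cell `i` of array `a`. -/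
def Memory.set (s : Memory) (a i v : ℕ) : Memory :=
  fun a' i' => if a' = a ∧ i' = i then v else s a' i'

/-- `Run p s t s'`: started in memory `s`, program `p` halts after time `t` in memory `s'`. -/
inductive Run : Program → Memory → ℕ → Memory → Prop where
  | skip (s : Memory) : Run .skip s 1 s
  | write (a : ℕ) (i e : Expr) (s : Memory) :
      Run (.write a i e) s (i.cost s + e.cost s + 1) (s.set a (i.eval s) (e.eval s))
  | seq {p q : Program} {s s₁ s₂ : Memory} {t₁ t₂ : ℕ} :
      Run p s t₁ s₁ → Run q s₁ t₂ s₂ → Run (.seq p q) s (t₁ + t₂ + 1) s₂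
  | ite_true {e : Expr} {p q : Program} {s s₁ : Memory} {t : ℕ} :
      e.eval s ≠ 0 → Run p s t s₁ → Run (.ite e p q) s (e.cost s + t + 1) s₁
  | ite_false {e : Expr} {p q : Program} {s s₁ : Memory} {t : ℕ} :
      e.eval s = 0 → Run q s t s₁ → Run (.ite e p q) s (e.cost s + t + 1) s₁
  | loop_done {e : Expr} {p : Program} {s : Memory} :
      e.eval s = 0 → Run (.loop e p) s (e.cost s + 1) s
  | loop_step {e : Expr} {p : Program} {s s₁ s₂ : Memory} {t₁ t₂ : ℕ} :
      e.eval s ≠ 0 → Run p s t₁ s₁ → Run (.loop e p) s₁ t₂ s₂ →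
      Run (.loop e p) s (e.cost s + t₁ + t₂ + 1) s₂

/-- Initially array `0` holds the input and every other cell is `0`. -/
def initial (w : List ℕ) : Memory := fun a i => if a = 0 then w.getD i 0 else 0

/-- The length of the input in binary, with one separator for every number. -/
def inputSize (w : List ℕ) : ℕ := (w.map fun k => Nat.size k + 1).sum

/-- The function `F` is computed in polynomial time: one program halts on every input within a
polynomial in the length of the input, with `0` or `1` in cell `0` of array `1`. -/
def ComputableInPolyTime {α : Type} (enc : α → List ℕ) (F : α → Bool) : Prop :=
  ∃ (p : Program) (T : Polynomial ℕ), ∀ x : α, ∃ (t : ℕ) (s : Memory),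
    Run p (initial (enc x)) t s ∧ t ≤ T.eval (inputSize (enc x)) ∧ s 1 0 = (F x).toNat

end CoalitionBribery

/-! Only first places matter, so a bribe amounts to the vote counts `v` that it produces together
with a set `S` of voters left alone. Such a pair is realizable exactly when the counts sum to `n`
and no party keeps more supporters in `S` than it has votes in `v`: the other voters can then be
distributed over the free places (`exists_extension`). Seat fractions share one denominator, so the
two targets become inequalities between active votes. This gives `isYes_iff_exists_isPlan`.

A finite entry of the dynamic program is attained by numbers of bribed supporters and of added
votes, party by party (`exists_of_h_ne_top`), and every such choice bounds an entry from above
(`h_le`). The algorithm ignores bribes that give votes to outsiders or that take more supporters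
from the preferred party than necessary. Nothing is lost: redirecting these votes to the preferred
party costs nothing, does not raise the active votes of the outsiders, and raises those of the
preferred party by some `e ≥ 0`. Since the support and the ratio are at most 1, adding `e` to both
sides preserves the targets (`algorithm_of_isPlan`).

Polynomial time is a statement about the Boolean answer alone, so the machine need not follow the
recurrence for `g`. It decides the existence of a plan by another dynamic program. Prices are scaled
to integers by the product of their denominators; `Input.keep` is the largest price that can be left
unpaid in a party with a given number of votes; and a table over the parties maximizes the kept
price for each combination of votes and active votes, encoded as the digits of one number
(`exec_main`, `solvable_iff`).

The time bound comes from the syntax. Loop bounds are polynomials in the numbers of parties and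
voters, which are at most the input length, and in every product the second factor has a bit length
controlled by the input. An assignment thus adds a bounded number of bits instead of doubling them,
and all bit lengths stay polynomial (`run_compile`). -/

namespace CoalitionBribery

/-! ### Programs with bounded loops -/

namespace Expr

/-- A syntactic bound on the constants and on the number of operations of an expression. -/
def weight : Expr → ℕ
  | const k => Nat.size k + 1
  | read _ i => i.weight + 1
  | add e₁ e₂ => e₁.weight + e₂.weight + 1
  | sub e₁ e₂ => e₁.weight + e₂.weight + 1
  | mul e₁ e₂ => e₁.weight + e₂.weight + 1

/-- Expressions whose value has a bit length bounded in terms of the input alone. -/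
def isSmall : Expr → Bool
  | const _ => true
  | read a _ => a == 0
  | add e₁ e₂ => e₁.isSmall && e₂.isSmall
  | sub e₁ _ => e₁.isSmall
  | mul e₁ e₂ => e₁.isSmall && e₂.isSmall

/-- Expressions in which the second factor of every product is small. -/
def isLinear : Expr → Bool
  | const _ => true
  | read _ i => i.isLinear
  | add e₁ e₂ => e₁.isLinear && e₂.isLinear
  | sub e₁ e₂ => e₁.isLinear && e₂.isLinear
  | mul e₁ e₂ => e₁.isLinear && e₂.isLinear && e₂.isSmall

/-- Expressions that are polynomials in the first two numbers of the input. -/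
def isBound : Expr → Bool
  | const _ => true
  | read a i => a == 0 && (match i with | const k => k == 0 || k == 1 | _ => false)
  | add e₁ e₂ => e₁.isBound && e₂.isBound
  | sub _ _ => false
  | mul e₁ e₂ => e₁.isBound && e₂.isBound

/-- A polynomial that bounds the value of a loop bound. -/
noncomputable def boundPoly : Expr → Polynomial ℕ
  | const k => Polynomial.C k
  | read _ _ => Polynomial.X
  | add e₁ e₂ => e₁.boundPoly + e₂.boundPoly
  | sub _ _ => 0
  | mul e₁ e₂ => e₁.boundPoly * e₂.boundPoly

end Expr

theorem size_add_le (a b : ℕ) : Nat.size (a + b) ≤ max (Nat.size a) (Nat.size b) + 1 := by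
  rw [Nat.size_le]
  have ha : a < 2 ^ max (Nat.size a) (Nat.size b) := Nat.size_le.1 (le_max_left _ _)
  have hb : b < 2 ^ max (Nat.size a) (Nat.size b) := Nat.size_le.1 (le_max_right _ _)
  rw [pow_succ]
  omega

theorem size_mul_le (a b : ℕ) : Nat.size (a * b) ≤ Nat.size a + Nat.size b := by
  rw [Nat.size_le, pow_add]
  exact Nat.mul_lt_mul'' (Nat.lt_size_self a) (Nat.lt_size_self b)

/-- The bit lengths of the input are at most `L`, and so are its first two numbers. -/
structure InputBound (s : Memory) (L : ℕ) : Prop where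
  size_le : ∀ i, Nat.size (s 0 i) ≤ L
  fst_le : s 0 0 ≤ L
  snd_le : s 0 1 ≤ L

theorem InputBound.congr {s s' : Memory} {L : ℕ} (hs : InputBound s L) (h : s' 0 = s 0) :
    InputBound s' L := by
  refine ⟨?_, ?_, ?_⟩ <;> rw [h]
  exacts [hs.size_le, hs.fst_le, hs.snd_le]

/-! ### Bit lengths and evaluation costs of expressions -/

namespace Expr

/-- Bit lengths add under multiplication, so the bound is linear in the weight. In a difference only
the minuend matters because subtraction is truncated; hence every comparison of the form `1 - e` is
small, whatever it compares. -/
theorem size_eval_le_of_isSmall {s : Memory} {L : ℕ} (hs : InputBound s L) (e : Expr)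
    (he : e.isSmall) : Nat.size (e.eval s) ≤ e.weight * (L + 1) := by
  induction e with
  | const k => simp only [eval, weight]; nlinarith
  | read a i ih =>
    simp only [isSmall, beq_iff_eq] at he
    subst he
    simp only [eval, weight]
    have := hs.size_le (i.eval s)
    nlinarith
  | add e₁ e₂ ih₁ ih₂ =>
    simp only [isSmall, Bool.and_eq_true] at he
    have h := size_add_le (e₁.eval s) (e₂.eval s)
    have h₁ := ih₁ he.1
    have h₂ := ih₂ he.2
    simp only [eval, weight]
    have : max (Nat.size (e₁.eval s)) (Nat.size (e₂.eval s)) ≤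
      Nat.size (e₁.eval s) + Nat.size (e₂.eval s) := by omega
    nlinarith
  | sub e₁ e₂ ih₁ _ =>
    have h₁ := ih₁ he
    simp only [eval, weight]
    have := Nat.size_le_size (Nat.sub_le (e₁.eval s) (e₂.eval s))
    nlinarith
  | mul e₁ e₂ ih₁ ih₂ =>
    simp only [isSmall, Bool.and_eq_true] at he
    have h := size_mul_le (e₁.eval s) (e₂.eval s)
    have h₁ := ih₁ he.1
    have h₂ := ih₂ he.2
    simp only [eval, weight]
    nlinarith

/-- The memory bound `S` enters with coefficient one: in a product only the first factor may depend
on working memory. A larger coefficient would allow exponential growth of the bit lengths when an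
assignment is repeated in a loop. -/
theorem size_eval_le {s : Memory} {L S : ℕ} (hs : InputBound s L)
    (hS : ∀ a i, Nat.size (s a i) ≤ S) (e : Expr) (he : e.isLinear) :
    Nat.size (e.eval s) ≤ S + e.weight * (L + 1) := by
  induction e with
  | const k => simp only [eval, weight]; nlinarith
  | read a i ih =>
    simp only [eval, weight]
    have := hS a (i.eval s)
    nlinarith
  | add e₁ e₂ ih₁ ih₂ =>
    simp only [isLinear, Bool.and_eq_true] at he
    have h := size_add_le (e₁.eval s) (e₂.eval s)
    have h₁ := ih₁ he.1
    have h₂ := ih₂ he.2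
    simp only [eval, weight]
    have : max (Nat.size (e₁.eval s)) (Nat.size (e₂.eval s)) ≤
      S + (e₁.weight + e₂.weight) * (L + 1) := max_le (by nlinarith) (by nlinarith)
    nlinarith
  | sub e₁ e₂ ih₁ _ =>
    simp only [isLinear, Bool.and_eq_true] at he
    have h₁ := ih₁ he.1
    simp only [eval, weight]
    have := Nat.size_le_size (Nat.sub_le (e₁.eval s) (e₂.eval s))
    nlinarith
  | mul e₁ e₂ ih₁ ih₂ =>
    simp only [isLinear, Bool.and_eq_true] at he
    have h := size_mul_le (e₁.eval s) (e₂.eval s)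
    have h₁ := ih₁ he.1.1
    have h₂ := size_eval_le_of_isSmall hs e₂ he.2
    simp only [eval, weight]
    nlinarith

theorem cost_le {s : Memory} {L S Y : ℕ} (hs : InputBound s L)
    (hS : ∀ a i, Nat.size (s a i) ≤ S) (e : Expr) (he : e.isLinear)
    (hY : S + e.weight * (L + 1) ≤ Y) : e.cost s ≤ e.weight * (Y + 1) := by
  have hsize := (size_eval_le hs hS e he).trans hY
  induction e with
  | const k => simp only [cost, weight]; nlinarith
  | read a i ih =>
    simp only [weight] at hY
    have hi : S + i.weight * (L + 1) ≤ Y := by nlinarith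
    have := ih he hi ((size_eval_le hs hS i he).trans hi)
    simp only [cost, weight, eval] at hsize ⊢
    nlinarith
  | add e₁ e₂ ih₁ ih₂ =>
    simp only [isLinear, Bool.and_eq_true] at he
    simp only [weight] at hY
    have h₁ : S + e₁.weight * (L + 1) ≤ Y := by nlinarith
    have h₂ : S + e₂.weight * (L + 1) ≤ Y := by nlinarith
    have := ih₁ he.1 h₁ ((size_eval_le hs hS _ he.1).trans h₁)
    have := ih₂ he.2 h₂ ((size_eval_le hs hS _ he.2).trans h₂)
    simp only [cost, weight, eval] at hsize ⊢
    nlinarith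
  | sub e₁ e₂ ih₁ ih₂ =>
    simp only [isLinear, Bool.and_eq_true] at he
    simp only [weight] at hY
    have h₁ : S + e₁.weight * (L + 1) ≤ Y := by nlinarith
    have h₂ : S + e₂.weight * (L + 1) ≤ Y := by nlinarith
    have := ih₁ he.1 h₁ ((size_eval_le hs hS _ he.1).trans h₁)
    have := ih₂ he.2 h₂ ((size_eval_le hs hS _ he.2).trans h₂)
    simp only [cost, weight, eval] at hsize ⊢
    nlinarith
  | mul e₁ e₂ ih₁ ih₂ =>
    simp only [isLinear, Bool.and_eq_true] at he
    simp only [weight] at hY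
    have h₁ : S + e₁.weight * (L + 1) ≤ Y := by nlinarith
    have h₂ : S + e₂.weight * (L + 1) ≤ Y := by nlinarith
    have := ih₁ he.1.1 h₁ ((size_eval_le hs hS _ he.1.1).trans h₁)
    have := ih₂ he.1.2 h₂ ((size_eval_le hs hS _ he.1.2).trans h₂)
    simp only [cost, weight, eval] at hsize ⊢
    nlinarith

theorem isLinear_of_isBound (e : Expr) (he : e.isBound) : e.isLinear ∧ e.isSmall := by
  induction e with
  | const k => simp [isLinear, isSmall]
  | read a i ih =>
    cases i <;> simp_all [isBound, isLinear, isSmall]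
  | add e₁ e₂ ih₁ ih₂ => simp_all [isBound, isLinear, isSmall]
  | sub e₁ e₂ => simp [isBound] at he
  | mul e₁ e₂ ih₁ ih₂ => simp_all [isBound, isLinear, isSmall]

theorem eval_le_boundPoly {s : Memory} {L : ℕ} (hs : InputBound s L) (e : Expr)
    (he : e.isBound) : e.eval s ≤ e.boundPoly.eval L := by
  induction e with
  | const k => simp [eval, boundPoly]
  | read a i ih =>
    cases i <;> simp [isBound] at he
    obtain ⟨rfl, rfl | rfl⟩ := he
    · simpa [eval, boundPoly] using hs.fst_le
    · simpa [eval, boundPoly] using hs.snd_le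
  | add e₁ e₂ ih₁ ih₂ =>
    simp only [isBound, Bool.and_eq_true] at he
    simpa [eval, boundPoly] using add_le_add (ih₁ he.1) (ih₂ he.2)
  | sub e₁ e₂ => simp [isBound] at he
  | mul e₁ e₂ ih₁ ih₂ =>
    simp only [isBound, Bool.and_eq_true] at he
    simpa [eval, boundPoly] using Nat.mul_le_mul (ih₁ he.1) (ih₂ he.2)

/-- A compiled loop evaluates its bound before every pass, while `exec` evaluates it once. The two
agree because bounds read only the input array, which is never changed. -/
theorem eval_congr_of_isBound {s s' : Memory} (h : s' 0 = s 0) (e : Expr) (he : e.isBound) :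
    e.eval s' = e.eval s := by
  induction e with
  | const k => rfl
  | read a i ih =>
    cases i <;> simp [isBound] at he
    obtain ⟨rfl, -⟩ := he
    simp [eval, h]
  | add e₁ e₂ ih₁ ih₂ =>
    simp only [isBound, Bool.and_eq_true] at he
    simp [eval, ih₁ he.1, ih₂ he.2]
  | sub e₁ e₂ => simp [isBound] at he
  | mul e₁ e₂ ih₁ ih₂ =>
    simp only [isBound, Bool.and_eq_true] at he
    simp [eval, ih₁ he.1, ih₂ he.2]

end Expr

/-- Programs whose loops `loop k e p` run the body `p` with the values `0, …, e - 1` in cell `0`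
of array `k`. -/
inductive ForProgram where
  | assign (a : ℕ) (i e : Expr)
  | seq (p q : ForProgram)
  | loop (k : ℕ) (e : Expr) (p : ForProgram)

/-! ### Semantics, compilation and running time of bounded loops -/

namespace ForProgram

/-- The value of a loop counter. -/
abbrev counter (k : ℕ) : Expr := .read k (.const 0)

/-- The memory in which a program halts. -/
def exec : ForProgram → Memory → Memory
  | assign a i e, s => s.set a (i.eval s) (e.eval s)
  | seq p q, s => exec q (exec p s)
  | loop k e p, s =>
    (fun s => (exec p s).set k 0 (exec p s k 0 + 1))^[e.eval s] (s.set k 0 0)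

/-- Translation to programs of the random access machine. -/
def compile : ForProgram → Program
  | assign a i e => .write a i e
  | seq p q => .seq p.compile q.compile
  | loop k e p =>
    .seq (.write k (.const 0) (.const 0))
      (.loop (.sub e (counter k))
        (.seq p.compile (.write k (.const 0) (.add (counter k) (.const 1)))))

/-- The arrays that a program may change. -/
def writes : ForProgram → ℕ → Bool
  | assign a _ _, b => b == a
  | seq p q, b => p.writes b || q.writes b
  | loop k _ p, b => b == k || p.writes b

/-- A syntactic condition for polynomial running time. -/
def isPoly : ForProgram → Bool
  | assign a i e => a != 0 && i.isLinear && e.isLinear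
  | seq p q => p.isPoly && q.isPoly
  | loop k e p => k != 0 && e.isBound && !p.writes k && p.isPoly

/-- A bound on the growth of the bit lengths in the memory. -/
noncomputable def growth : ForProgram → Polynomial ℕ
  | assign _ i e => Polynomial.C (i.weight + e.weight) * (Polynomial.X + 1)
  | seq p q => p.growth + q.growth
  | loop _ e p =>
    (e.boundPoly + 1) * (p.growth + Polynomial.C (e.weight + 10) * (Polynomial.X + 1))

/-- A bound on the running time in terms of the bit lengths in the memory. -/
noncomputable def time : ForProgram → Polynomial ℕ
  | assign _ i e => Polynomial.C (i.weight + e.weight + 1) * (Polynomial.X + 1)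
  | seq p q => p.time + q.time + 1
  | loop _ e p =>
    (e.boundPoly + 1) * (p.time + Polynomial.C (e.weight + 20) * (Polynomial.X + 1)) +
      Polynomial.C 20 * (Polynomial.X + 1)

theorem exec_apply_of_not_writes (p : ForProgram) (s : Memory) {b : ℕ} (hb : p.writes b = false) :
    p.exec s b = s b := by
  induction p generalizing s with
  | assign a i e =>
    simp only [writes, beq_eq_false_iff_ne] at hb
    funext j
    simp [exec, Memory.set, hb]
  | seq p q ihp ihq =>
    simp only [writes, Bool.or_eq_false_iff] at hb
    simp [exec, ihp _ hb.1, ihq _ hb.2]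
  | loop k e p ih =>
    simp only [writes, Bool.or_eq_false_iff, beq_eq_false_iff_ne] at hb
    have set_apply : ∀ (s : Memory) i v, s.set k i v b = s b := fun s i v => by
      funext j
      simp [Memory.set, hb.1]
    simp only [exec]
    generalize e.eval s = N
    rw [← set_apply s 0 0]
    generalize s.set k 0 0 = s
    induction N generalizing s with
    | zero => rfl
    | succ N ihN => rw [Function.iterate_succ_apply, ihN, set_apply, ih _ hb.2]

theorem not_writes_zero (p : ForProgram) (hp : p.isPoly) : p.writes 0 = false := by
  induction p with
  | assign a i e =>
    simp only [isPoly, Bool.and_eq_true, bne_iff_ne, ne_eq] at hp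
    simp only [writes, beq_eq_false_iff_ne]
    exact fun h => hp.1.1 h.symm
  | seq p q ihp ihq =>
    simp only [isPoly, Bool.and_eq_true] at hp
    simp [writes, ihp hp.1, ihq hp.2]
  | loop k e p ih =>
    simp only [isPoly, Bool.and_eq_true, bne_iff_ne, ne_eq] at hp
    simp only [writes, Bool.or_eq_false_iff, beq_eq_false_iff_ne]
    exact ⟨fun h => hp.1.1.1 h.symm, ih hp.2⟩

theorem eval_mono (p : Polynomial ℕ) {a b : ℕ} (h : a ≤ b) : p.eval a ≤ p.eval b := by
  rw [Polynomial.eval_eq_sum, Polynomial.eval_eq_sum]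
  exact Finset.sum_le_sum fun i _ => Nat.mul_le_mul_left _ (Nat.pow_le_pow_left h i)

theorem size_set_le {s : Memory} {S a i v : ℕ} (hS : ∀ b j, Nat.size (s b j) ≤ S)
    (hv : Nat.size v ≤ S) (b j : ℕ) : Nat.size (s.set a i v b j) ≤ S := by
  unfold Memory.set
  split
  exacts [hv, hS b j]

/-- Each pass adds at most `G` bits and takes time at most `τ`. The number `r` counts the passes
still to come, so that the induction can start from a loop under way. The extra summand `G` in `hY`
covers the final, failing test. -/
theorem run_loop {p : ForProgram} {e : Expr} {k L Y g τ₀ : ℕ} (hk : k ≠ 0) (he : e.isBound)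
    (hpk : p.writes k = false) (hp0 : p.writes 0 = false)
    (ih : ∀ {S : ℕ} {s : Memory}, InputBound s L → (∀ a i, Nat.size (s a i) ≤ S) → S + g ≤ Y →
      ∃ t, Run p.compile s t (p.exec s) ∧ t ≤ τ₀ ∧ ∀ a i, Nat.size (p.exec s a i) ≤ S + g)
    {G τ : ℕ} (hG : G = g + (e.weight + 10) * (L + 1)) (hτ : τ = τ₀ + (e.weight + 20) * (Y + 1))
    (r : ℕ) {S : ℕ} {s : Memory} (hs : InputBound s L) (hS : ∀ a i, Nat.size (s a i) ≤ S)
    (hY : S + (r + 1) * G ≤ Y) (he' : e.eval s = s k 0 + r) :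
    ∃ t, Run (.loop (.sub e (counter k))
      (.seq p.compile (.write k (.const 0) (.add (counter k) (.const 1))))) s t
      ((fun s => (exec p s).set k 0 (exec p s k 0 + 1))^[r] s) ∧ t ≤ (r + 1) * τ ∧
      ∀ a i, Nat.size ((fun s => (exec p s).set k 0 (exec p s k 0 + 1))^[r] s a i)
        ≤ S + r * G := by
  have hlin := Expr.isLinear_of_isBound e he
  have hset : ∀ (s : Memory) i v, s.set k i v 0 = s 0 := fun s i v => by
    funext j
    simp [Memory.set, Ne.symm hk]
  have hGY : S + G ≤ Y := by
    have : (r + 1) * G = r * G + G := by ring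
    omega
  have hG' : G = g + (e.weight * (L + 1) + 10 * L + 10) := by rw [hG]; ring
  have hτ' : τ = τ₀ + (e.weight * (Y + 1) + 20 * Y + 20) := by rw [hτ]; ring
  have hw : (e.weight + (0 + 1 + 1) + 1) * (L + 1) = e.weight * (L + 1) + 3 * L + 3 := by ring
  have hwY : (e.weight + (0 + 1 + 1) + 1) * (Y + 1) = e.weight * (Y + 1) + 3 * Y + 3 := by ring
  have hc := Expr.cost_le hs hS (.sub e (counter k)) (by simp [Expr.isLinear, hlin.1])
    (Y := Y) (by simp only [Expr.weight, Nat.size_zero]; omega)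
  simp only [Expr.weight, Nat.size_zero] at hc
  induction r generalizing S s with
  | zero =>
    refine ⟨_, Run.loop_done (by simp [Expr.eval, he']), ?_, by simpa using hS⟩
    omega
  | succ r ihr =>
    obtain ⟨t₁, h₁, ht₁, hS₁⟩ := ih hs hS (by omega)
    have h0 := exec_apply_of_not_writes p s hp0
    have hs₁ := InputBound.congr hs h0
    have hc₁ := Expr.cost_le hs₁ hS₁ (.add (counter k) (.const 1)) (by simp [Expr.isLinear])
      (Y := Y) (by simp only [Expr.weight, Nat.size_zero, Nat.size_one]; omega)
    have hv := Expr.size_eval_le hs₁ hS₁ (.add (counter k) (.const 1)) (by simp [Expr.isLinear])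
    simp only [Expr.weight, Nat.size_zero, Nat.size_one, Expr.eval] at hc₁ hv
    have hkk := congrFun (exec_apply_of_not_writes p s hpk) 0
    have hmul : (r + 1 + 1) * G = r * G + G + G := by ring
    have hmul' : (r + 1) * G = r * G + G := by ring
    have hmulτ : (r + 1 + 1) * τ = (r + 1) * τ + τ := by ring
    have hs₂ := InputBound.congr hs₁ (hset (exec p s) 0 (exec p s k 0 + 1))
    have hS₂ : ∀ b j, Nat.size ((exec p s).set k 0 (exec p s k 0 + 1) b j) ≤ S + G :=
      size_set_le (fun b j => (hS₁ b j).trans (by omega)) (by omega)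
    have hc₂ := Expr.cost_le hs₂ hS₂ (.sub e (counter k)) (by simp [Expr.isLinear, hlin.1])
      (Y := Y) (by simp only [Expr.weight, Nat.size_zero]; omega)
    simp only [Expr.weight, Nat.size_zero] at hc₂
    obtain ⟨t₂, h₂, ht₂, hS₃⟩ := ihr hs₂ hS₂ (by omega)
      (by
        rw [Expr.eval_congr_of_isBound (hset _ _ _) e he, Expr.eval_congr_of_isBound h0 e he,
          he', hkk]
        simp [Memory.set]
        omega) (by omega) hc₂
    refine ⟨_, Run.loop_step (by simp [Expr.eval, he'])
      (Run.seq h₁ (Run.write k (.const 0) (.add (counter k) (.const 1)) _)) h₂, ?_, ?_⟩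
    · simp only [Expr.cost, Nat.size_zero] at hc hc₁ ⊢
      omega
    · intro a i
      refine (hS₃ a i).trans ?_
      omega

/-- The growth is measured in the input bound `L`, which stays fixed while the memory bound `S`
increases. So growth polynomials are added or multiplied by pass counts and never composed with each
other. The number `Y` dominates all bit lengths of the run, and the time is a polynomial in `Y`. -/
theorem run_compile (p : ForProgram) (hp : p.isPoly) {L S Y : ℕ} {s : Memory}
    (hs : InputBound s L) (hS : ∀ a i, Nat.size (s a i) ≤ S) (hY : S + p.growth.eval L ≤ Y)
    (hL : L ≤ Y) :
    ∃ t, Run p.compile s t (p.exec s) ∧ t ≤ p.time.eval Y ∧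
      ∀ a i, Nat.size (p.exec s a i) ≤ S + p.growth.eval L := by
  induction p generalizing s S with
  | assign a i e =>
    simp only [isPoly, Bool.and_eq_true] at hp
    simp only [growth, Polynomial.eval_mul, Polynomial.eval_C, Polynomial.eval_add,
      Polynomial.eval_X, Polynomial.eval_one] at hY ⊢
    refine ⟨_, Run.write a i e s, ?_, ?_⟩
    · have h₁ := Expr.cost_le hs hS i hp.1.2 (Y := Y) (by nlinarith)
      have h₂ := Expr.cost_le hs hS e hp.2 (Y := Y) (by nlinarith)
      simp only [time, Polynomial.eval_mul, Polynomial.eval_C, Polynomial.eval_add,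
        Polynomial.eval_X, Polynomial.eval_one]
      nlinarith
    · refine size_set_le (fun b j => (hS b j).trans (Nat.le_add_right _ _)) ?_
      have := Expr.size_eval_le hs hS e hp.2
      nlinarith
  | seq p q ihp ihq =>
    simp only [isPoly, Bool.and_eq_true] at hp
    simp only [growth, Polynomial.eval_add] at hY ⊢
    obtain ⟨t₁, h₁, ht₁, hS₁⟩ := ihp hp.1 hs hS (by omega)
    have hs₁ := InputBound.congr hs (exec_apply_of_not_writes p s (not_writes_zero p hp.1))
    obtain ⟨t₂, h₂, ht₂, hS₂⟩ := ihq hp.2 hs₁ hS₁ (by omega)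
    refine ⟨_, Run.seq h₁ h₂, ?_, fun a i => (hS₂ a i).trans (by omega)⟩
    simp only [time, Polynomial.eval_add, Polynomial.eval_one]
    omega
  | loop k e p ih =>
    simp only [isPoly, Bool.and_eq_true, bne_iff_ne, ne_eq, Bool.not_eq_true'] at hp
    obtain ⟨⟨⟨hk, he⟩, hpk⟩, hp⟩ := hp
    have hN := Expr.eval_le_boundPoly hs e he
    have hset : ∀ (s : Memory) i v, s.set k i v 0 = s 0 := fun s i v => by
      funext j
      simp [Memory.set, Ne.symm hk]
    simp only [growth, Polynomial.eval_mul, Polynomial.eval_C, Polynomial.eval_add,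
      Polynomial.eval_X, Polynomial.eval_one] at hY ⊢
    set G := p.growth.eval L + (e.weight + 10) * (L + 1) with hG
    set τ := p.time.eval Y + (e.weight + 20) * (Y + 1) with hτ
    obtain ⟨t, h, ht, hS'⟩ := run_loop hk he hpk (not_writes_zero p hp)
      (fun hs hS hY => ih hp hs hS hY) hG hτ (e.eval s) (S := S) (s := s.set k 0 0)
      (InputBound.congr hs (hset _ _ _))
      (size_set_le hS (by simp))
      ((Nat.add_le_add_left (Nat.mul_le_mul_right _ (Nat.add_le_add_right hN 1)) _).trans hY)
      (by rw [Expr.eval_congr_of_isBound (hset _ _ _) e he]; simp [Memory.set])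
    have hbp := eval_mono e.boundPoly hL
    refine ⟨_, Run.seq (Run.write k (.const 0) (.const 0) s) h, ?_, ?_⟩
    · simp only [time, Polynomial.eval_mul, Polynomial.eval_C, Polynomial.eval_add,
        Polynomial.eval_X, Polynomial.eval_one, Expr.cost, Nat.size_zero]
      rw [← hτ]
      have := Nat.mul_le_mul_right τ (Nat.add_le_add_right (hN.trans hbp) 1)
      omega
    · intro a i
      exact (hS' a i).trans
        (Nat.add_le_add_left (Nat.mul_le_mul_right _ (hN.trans (Nat.le_succ _))) _)

end ForProgram

/-! ### Polynomial time from the syntactic condition -/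

theorem length_le_inputSize (w : List ℕ) : w.length ≤ inputSize w := by
  induction w with
  | nil => simp
  | cons k w ih => simp only [inputSize, List.map_cons, List.sum_cons, List.length_cons] at ih ⊢; omega

theorem size_getD_le_inputSize (w : List ℕ) (i : ℕ) : Nat.size (w.getD i 0) ≤ inputSize w := by
  induction w generalizing i with
  | nil => simp
  | cons k w ih =>
    simp only [inputSize, List.map_cons, List.sum_cons]
    cases i with
    | zero => simp; omega
    | succ i => have := ih i; simp only [inputSize, List.getD_cons_succ] at this ⊢; omega

/-- A program that meets the syntactic condition runs in polynomial time on inputs whose first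
two numbers are at most their length. -/
theorem computableInPolyTime_of_forProgram {α : Type} {enc : α → List ℕ} {F : α → Bool}
    (p : ForProgram) (hp : p.isPoly) (h₀ : ∀ x, (enc x).getD 0 0 ≤ inputSize (enc x))
    (h₁ : ∀ x, (enc x).getD 1 0 ≤ inputSize (enc x))
    (hF : ∀ x, p.exec (initial (enc x)) 1 0 = (F x).toNat) : ComputableInPolyTime enc F := by
  -- Here `Y` is the input length plus the total growth.
  refine ⟨p.compile, p.time.comp (Polynomial.X + p.growth), fun x => ?_⟩
  obtain ⟨t, h, ht, -⟩ := p.run_compile hp (s := initial (enc x)) (L := inputSize (enc x))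
    (S := inputSize (enc x)) ⟨fun i => size_getD_le_inputSize _ i, h₀ x, h₁ x⟩
    (fun a i => by
      unfold initial
      split
      · exact size_getD_le_inputSize _ i
      · simp) le_rfl (Nat.le_add_right _ _)
  refine ⟨t, _, h, ?_, hF x⟩
  simpa using ht

/-! ### Bribes as vote counts with a set of voters that are left alone -/

/-- The top party of an order. -/
def top {m : ℕ} (c₀ : Fin m) (O : PrefOrder m) : Fin m := O.symm ⟨0, c₀.pos⟩

theorem pos_eq_one_iff {m : ℕ} (c₀ : Fin m) (O : PrefOrder m) (c : Fin m) :
    pos O c = 1 ↔ top c₀ O = c := by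
  simp only [pos, top, Nat.add_eq_right, Equiv.symm_apply_eq, Fin.ext_iff]
  exact eq_comm

theorem points_plurality {m n : ℕ} (c₀ : Fin m) (P : Fin n → PrefOrder m) (S : Finset (Fin m)) :
    points plurality P S = ∑ c ∈ S, (Finset.univ.filter fun i => top c₀ (P i) = c).card := by
  simp only [points, plurality, pos_eq_one_iff c₀]
  rw [Finset.sum_comm]
  simp only [Finset.card_filter]

theorem sum_card_top {m n : ℕ} (τ : Fin n → Fin m) :
    ∑ c, (Finset.univ.filter fun i => τ i = c).card = n := by
  rw [← Finset.card_eq_sum_card_fiberwise (fun _ _ => Finset.mem_coe.2 (Finset.mem_univ _)),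
    Finset.card_univ, Fintype.card_fin]

/-- A partial assignment that respects the capacities `v` extends to one that meets them. -/
theorem exists_extension {m n : ℕ} (v : Fin m → ℕ) (hv : ∑ c, v c = n) (S : Finset (Fin n))
    (τ : Fin n → Fin m) (hS : ∀ c, (S.filter fun i => τ i = c).card ≤ v c) :
    ∃ τ' : Fin n → Fin m, (∀ i ∈ S, τ' i = τ i) ∧
      ∀ c, (Finset.univ.filter fun i => τ' i = c).card = v c := by
  have hsum : ∀ (S : Finset (Fin n)) (τ : Fin n → Fin m),
      ∑ c, (S.filter fun i => τ i = c).card = S.card := fun S τ =>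
    (Finset.card_eq_sum_card_fiberwise fun _ _ => Finset.mem_coe.2 (Finset.mem_univ _)).symm
  induction hk : Sᶜ.card generalizing S τ with
  | zero =>
    have hSu : S = Finset.univ := by simpa using hk
    subst hSu
    refine ⟨τ, fun _ _ => rfl, fun c => ?_⟩
    have h := (Finset.sum_eq_sum_iff_of_le (fun c _ => hS c)).1
      ((hsum _ τ).trans (by simp [hv]))
    exact h c (Finset.mem_univ c)
  | succ k ih =>
    obtain ⟨i, hi⟩ : Sᶜ.Nonempty := Finset.card_pos.1 (by omega)
    rw [Finset.mem_compl] at hi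
    -- Fewer voters are placed than the capacities allow in total, so some party has room for voter
    -- `i`.
    obtain ⟨c, -, hc⟩ : ∃ c ∈ Finset.univ, (S.filter fun i => τ i = c).card < v c := by
      apply Finset.exists_lt_of_sum_lt
      rw [hsum, hv]
      have := Finset.card_compl S
      rw [Fintype.card_fin] at this
      omega
    have hne : ∀ j ∈ S, j ≠ i := fun j hj h => hi (h ▸ hj)
    have hupd : ∀ d, (S.filter fun j => Function.update τ i c j = d)
        = S.filter fun j => τ j = d := fun d =>
      Finset.filter_congr fun j hj => by rw [Function.update_of_ne (hne j hj)]
    obtain ⟨τ', h₁, h₂⟩ := ih (insert i S) (Function.update τ i c) (fun d => by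
      rw [Finset.filter_insert, hupd, Function.update_self]
      split
      · next h =>
        subst h
        exact (Finset.card_insert_le _ _).trans hc
      · exact hS d) (by
      rw [Finset.card_compl] at hk ⊢
      rw [Finset.card_insert_of_notMem hi]
      omega)
    refine ⟨τ', fun j hj => ?_, h₂⟩
    rw [h₁ j (Finset.mem_insert_of_mem hj), Function.update_of_ne (hne j hj)]

/-! ### Reduction of the question to vote counts -/

namespace Instance

variable (I : Instance)

/-- The active votes of a party with `x` votes. -/
def active (x : ℕ) : ℕ := if (x : ℚ≥0) < I.quota then 0 else x

theorem active_le (x : ℕ) : I.active x ≤ x := by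
  unfold active
  split <;> omega

theorem active_mono {x y : ℕ} (h : x ≤ y) : I.active x ≤ I.active y := by
  unfold active
  split_ifs with h₁ h₂
  · exact le_rfl
  · exact Nat.zero_le _
  · next h₂ => exact absurd (lt_of_le_of_lt (Nat.cast_le.2 h) h₂) h₁
  · exact h

/-- The targets are met by the vote counts `v`. -/
def MeetsTargets (v : Fin I.m → ℕ) : Prop :=
  I.support * ((∑ c, I.active (v c) : ℕ) : ℚ≥0)
      ≤ ((∑ c ∈ I.coalition, I.active (v c) : ℕ) : ℚ≥0) ∧
    I.ratio * ((∑ c ∈ I.coalition, I.active (v c) : ℕ) : ℚ≥0)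
      ≤ (I.active (v I.preferred) : ℚ≥0)

/-- The vote counts `v` meet the targets and can be reached within the budget by bribing voters
outside of `S`. -/
def IsPlan (v : Fin I.m → ℕ) (S : Finset (Fin I.n)) : Prop :=
  ∑ c, v c = I.n ∧ (∀ c, (I.supporters c ∩ S).card ≤ v c) ∧
    ∑ i ∈ Sᶜ, I.price i ≤ I.budget ∧ I.MeetsTargets v

/-- The top party of a voter. -/
def topOf (i : Fin I.n) : Fin I.m := top I.preferred (I.order i)

theorem mem_supporters {c : Fin I.m} {i : Fin I.n} : i ∈ I.supporters c ↔ I.topOf i = c := by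
  simp [supporters, topOf, pos_eq_one_iff I.preferred]

theorem sum_card_supporters : ∑ c, (I.supporters c).card = I.n := by
  refine Eq.trans (Finset.sum_congr rfl fun c _ => congrArg Finset.card ?_) (sum_card_top I.topOf)
  ext i
  simp [mem_supporters]

/-- The vote counts of a profile. -/
def votes (P : Fin I.n → PrefOrder I.m) (c : Fin I.m) : ℕ :=
  (Finset.univ.filter fun i => top I.preferred (P i) = c).card

theorem points_singleton (P : Fin I.n → PrefOrder I.m) (c : Fin I.m) :
    points plurality P {c} = I.votes P c := by
  rw [points_plurality I.preferred, Finset.sum_singleton, votes]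

theorem isActive_iff (P : Fin I.n → PrefOrder I.m) (c : Fin I.m) :
    IsActive plurality I.threshold P c ↔ ¬ ((I.votes P c : ℚ≥0) < I.quota) := by
  simp only [IsActive, points_plurality I.preferred, Finset.sum_singleton, sum_card_top, votes,
    quota]

theorem seats_eq (P : Fin I.n → PrefOrder I.m) (c : Fin I.m) :
    seats plurality I.threshold P c =
      (I.active (I.votes P c) : ℚ≥0) / ((∑ c, I.active (I.votes P c) : ℕ) : ℚ≥0) := by
  have hT : (∑ c' with IsActive plurality I.threshold P c', (points plurality P {c'} : ℚ≥0))
      = ((∑ c, I.active (I.votes P c) : ℕ) : ℚ≥0) := by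
    rw [Finset.sum_filter]
    push_cast
    refine Finset.sum_congr rfl fun c _ => ?_
    simp only [isActive_iff, active, I.points_singleton]
    split_ifs <;> simp
  unfold seats
  rw [hT]
  simp only [isActive_iff, I.points_singleton]
  by_cases h : (I.votes P c : ℚ≥0) < I.quota
  · rw [if_neg (not_not.2 h), active, if_pos h, Nat.cast_zero, zero_div]
  · rw [if_pos h, active, if_neg h]

theorem seatsOf_eq (P : Fin I.n → PrefOrder I.m) (S : Finset (Fin I.m)) :
    seatsOf plurality I.threshold P S =
      ((∑ c ∈ S, I.active (I.votes P c) : ℕ) : ℚ≥0) /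
        ((∑ c, I.active (I.votes P c) : ℕ) : ℚ≥0) := by
  simp only [seatsOf, seats_eq, ← Finset.sum_div]
  push_cast
  rfl

/-- The bounds by `z` handle `z = 0`, where division returns 0: then `x` and `y` vanish too and both
inequalities hold. This is the case of an election without active votes. -/
theorem mul_div_le_div_iff {q x y z : ℚ≥0} (hx : x ≤ z) (hy : y ≤ z) :
    q * (x / z) ≤ y / z ↔ q * x ≤ y := by
  rcases eq_or_ne z 0 with rfl | hz
  · simp [nonpos_iff_eq_zero.1 hx, nonpos_iff_eq_zero.1 hy]
  · rw [← mul_div_assoc, div_le_div_iff_of_pos_right (pos_iff_ne_zero.2 hz)]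

theorem meetsTargets_iff (P : Fin I.n → PrefOrder I.m) :
    I.MeetsTargets (I.votes P) ↔
      I.support * seatsOf plurality I.threshold P Finset.univ
        ≤ seatsOf plurality I.threshold P I.coalition ∧
      I.ratio * seatsOf plurality I.threshold P I.coalition
        ≤ seats plurality I.threshold P I.preferred := by
  have hA : ((∑ c ∈ I.coalition, I.active (I.votes P c) : ℕ) : ℚ≥0)
      ≤ ((∑ c, I.active (I.votes P c) : ℕ) : ℚ≥0) :=
    Nat.cast_le.2 (Finset.sum_le_sum_of_subset (Finset.subset_univ _))
  have hp : (I.active (I.votes P I.preferred) : ℚ≥0)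
      ≤ ((∑ c, I.active (I.votes P c) : ℕ) : ℚ≥0) :=
    Nat.cast_le.2 (Finset.single_le_sum (f := fun c => I.active (I.votes P c))
      (fun _ _ => Nat.zero_le _) (Finset.mem_univ _))
  rw [seatsOf_eq, seatsOf_eq, seats_eq, mul_div_le_div_iff le_rfl hA, mul_div_le_div_iff hA hp,
    MeetsTargets]

theorem bribeCost_eq (P : Fin I.n → PrefOrder I.m) :
    I.bribeCost P = ∑ i ∈ (Finset.univ.filter fun i => P i = I.order i)ᶜ, I.price i := by
  rw [bribeCost, Finset.compl_filter, Finset.sum_filter]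
  simp

/-- A voter in `S` keeps its top party and a voter outside can be given any top party, so the kept
supporters fitting into the counts is the only constraint between `v` and `S`. -/
theorem isYes_iff_exists_isPlan : I.IsYes ↔ ∃ v S, I.IsPlan v S := by
  constructor
  · rintro ⟨P, hB, hT⟩
    refine ⟨I.votes P, Finset.univ.filter fun i => P i = I.order i, sum_card_top _, fun c => ?_,
      I.bribeCost_eq P ▸ hB, (I.meetsTargets_iff P).2 hT⟩
    refine Finset.card_le_card fun i hi => ?_
    simp only [Finset.mem_inter, mem_supporters, Finset.mem_filter, Finset.mem_univ,
      true_and, topOf] at hi ⊢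
    rw [hi.2, hi.1]
  · rintro ⟨v, S, hv, hS, hB, hT⟩
    obtain ⟨τ, hτ, hc⟩ := exists_extension v hv S I.topOf fun c => by
      refine (Finset.card_le_card fun i hi => ?_).trans (hS c)
      simpa [mem_supporters, and_comm] using hi
    -- Swapping the old and the new top party is the identity if they agree, so voters in `S` keep
    -- their whole order and cost nothing.
    let P : Fin I.n → PrefOrder I.m := fun i =>
      (Equiv.swap (τ i) (I.topOf i)).trans (I.order i)
    have htop : ∀ i, top I.preferred (P i) = τ i := fun i => by
      simp only [top, P, Equiv.symm_trans_apply, Equiv.symm_swap]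
      exact Equiv.swap_apply_right _ _
    have hvotes : I.votes P = v := by
      funext c
      simp only [votes, htop]
      exact hc c
    refine ⟨P, ?_, (I.meetsTargets_iff P).1 (hvotes ▸ hT)⟩
    rw [bribeCost_eq]
    -- A voter outside `S` may also retain its order, so the cost is at most the price of the
    -- complement and not always equal to it.
    refine (Finset.sum_le_sum_of_subset fun i hi => ?_).trans hB
    simp only [Finset.mem_compl, Finset.mem_filter, Finset.mem_univ, true_and] at hi ⊢
    intro hiS
    apply hi
    simp only [P, hτ i hiS, Equiv.swap_self]
    rfl

/-! ### The dynamic program -/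

/-- If the sublist omits the head, replacing the head in the prefix by one more entry further on
does not lower the sum, since the list is sorted. -/
theorem sum_take_le_sum_of_sublist {M L : List ℚ≥0} (h : M.Sublist L)
    (hL : L.Pairwise (· ≤ ·)) : (L.take M.length).sum ≤ M.sum := by
  induction h with
  | slnil => simp
  | @cons M L a h ih =>
    refine le_trans ?_ (ih hL.of_cons)
    rcases hM : M.length with _ | k
    · simp
    · have hk : k < L.length := by have := h.length_le; omega
      rw [List.take_succ_cons, List.sum_cons, List.take_add_one, List.getElem?_eq_getElem hk,
        List.sum_append, add_comm]
      simp only [Option.toList_some, List.sum_singleton]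
      gcongr
      exact (List.pairwise_cons.1 hL).1 _ (List.getElem_mem hk)
  | cons_cons a h ih =>
    simp only [List.length_cons, List.take_succ_cons, List.sum_cons]
    gcongr
    exact ih hL.of_cons

theorem mincost_le (c : Fin I.m) {U : Finset (Fin I.n)} (hU : U ⊆ I.supporters c) :
    I.mincost c U.card ≤ ((∑ i ∈ U, I.price i : ℚ≥0) : WithTop ℚ≥0) := by
  rw [mincost, if_pos (Finset.card_le_card hU), WithTop.coe_le_coe]
  have hsub : ((U.val.map I.price).sort (· ≤ ·)).Sublist
      (((I.supporters c).val.map I.price).sort (· ≤ ·)) := by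
    refine List.sublist_of_subperm_of_sortedLE ?_ (Multiset.pairwise_sort _ _).sortedLE
      (Multiset.pairwise_sort _ _).sortedLE
    rw [← Multiset.coe_le, Multiset.sort_eq, Multiset.sort_eq]
    exact Multiset.map_le_map (Finset.val_le_iff.2 hU)
  have h := sum_take_le_sum_of_sublist hsub (Multiset.pairwise_sort _ _)
  rw [Multiset.length_sort, Multiset.card_map, Finset.card_val] at h
  refine h.trans (le_of_eq ?_)
  rw [← Multiset.sum_coe, Multiset.sort_eq]
  rfl

/-- Sorting the voters by price, instead of the prices themselves, recovers voters that attain the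
minimum. Ties leave the order of the voters undetermined but not the list of their prices. -/
theorem exists_sum_eq_mincost (c : Fin I.m) {l : ℕ} (hl : l ≤ (I.supporters c).card) :
    ∃ U ⊆ I.supporters c, U.card = l ∧
      I.mincost c l = ((∑ i ∈ U, I.price i : ℚ≥0) : WithTop ℚ≥0) := by
  let r : Fin I.n → Fin I.n → Prop := fun i j => I.price i ≤ I.price j
  have : Std.Total r := ⟨fun i j => le_total _ _⟩
  have : IsTrans (Fin I.n) r := ⟨fun i j k => le_trans⟩
  let L := (I.supporters c).toList.insertionSort r
  have hperm : L.Perm (I.supporters c).toList := List.perm_insertionSort _ _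
  have hL : L.map I.price = ((I.supporters c).val.map I.price).sort (· ≤ ·) := by
    refine List.Perm.eq_of_pairwise (le := (· ≤ ·)) (fun a b _ _ => le_antisymm) ?_
      (Multiset.pairwise_sort _ _) ?_
    · rw [List.pairwise_map]
      exact List.pairwise_insertionSort r _
    · rw [← Multiset.coe_eq_coe, Multiset.sort_eq, ← Multiset.map_coe,
        Multiset.coe_eq_coe.2 hperm, Finset.coe_toList]
  have hnd : L.Nodup := hperm.nodup_iff.2 (Finset.nodup_toList _)
  have hlen : L.length = (I.supporters c).card := by rw [hperm.length_eq, Finset.length_toList]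
  have hnd' : (L.take l).Nodup := hnd.sublist (List.take_sublist _ _)
  refine ⟨(L.take l).toFinset, fun i hi => ?_, ?_, ?_⟩
  · rw [List.mem_toFinset] at hi
    exact Finset.mem_toList.1 (hperm.mem_iff.1 (List.mem_of_mem_take hi))
  · rw [List.toFinset_card_of_nodup hnd', List.length_take, hlen]
    omega
  · rw [mincost, if_pos hl, List.sum_toFinset _ hnd', ← hL, List.map_take]

theorem hOne_active (c : Fin I.m) (l d : ℕ) :
    I.hOne c l d (I.active ((I.supporters c).card - l + d)) = I.mincost c l := by
  simp only [hOne]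
  refine if_pos ?_
  by_cases h : (((I.supporters c).card - l + d : ℕ) : ℚ≥0) < I.quota
  · exact Or.inr ⟨h, if_pos h⟩
  · exact Or.inl ⟨not_lt.1 h, if_neg h⟩

/-- The truncation in `card - l` is harmless for finite entries, because `mincost` is already
infinite for `l` beyond the number of supporters. -/
theorem eq_active_of_hOne_ne_top {c : Fin I.m} {l d a : ℕ} (h : I.hOne c l d a ≠ ⊤) :
    l ≤ (I.supporters c).card ∧ a = I.active ((I.supporters c).card - l + d) := by
  simp only [hOne] at h
  split at h
  · next h₁ =>
    refine ⟨?_, ?_⟩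
    · by_contra hl
      rw [mincost, if_neg hl] at h
      exact h rfl
    · rcases h₁ with h₁ | h₁
      · rw [active, if_neg (not_lt.2 h₁.1), h₁.2]
      · rw [active, if_pos h₁.1, h₁.2]
  · exact absurd rfl h

/-- Outsiders are parties that gain no votes, so results on `h` serve for both tables. -/
theorem f_eq_h (D : List (Fin I.m)) (l a : ℕ) : I.f D l a = I.h D l 0 a := by
  induction D generalizing l a with
  | nil => simp [f, h]
  | cons c D ih => simp [f, h, ih, fOne, hOne]

/-- Every distribution of bribes and added votes competes in the minimum at the totals that it
produces. No bound on `x` is needed: bribing more voters than a party has makes the right side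
infinite. -/
theorem h_le (D : List (Fin I.m)) (x y : Fin I.m → ℕ) :
    I.h D (D.map x).sum (D.map y).sum
        (D.map fun c => I.active ((I.supporters c).card - x c + y c)).sum
      ≤ (D.map fun c => I.mincost c (x c)).sum := by
  induction D with
  | nil => simp [h]
  | cons c D ih =>
    simp only [List.map_cons, List.sum_cons, h]
    refine (Finset.inf_le (b := (D.map x).sum) (by simp)).trans ?_
    refine (Finset.inf_le (b := (D.map y).sum) (by simp)).trans ?_
    refine (Finset.inf_le
      (b := (D.map fun c => I.active ((I.supporters c).card - x c + y c)).sum) (by simp)).trans ?_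
    simp only [Nat.add_sub_cancel_right, hOne_active]
    rw [add_comm]
    gcongr

/-- A minimum over a nonempty finite range is attained, so the choices can be traced back through
the recurrence. As the list has no duplicates, fixing the choice at `c` leaves those for `D` alone.
-/
theorem exists_of_h_ne_top {D : List (Fin I.m)} (hD : D.Nodup) {l d a : ℕ}
    (hne : I.h D l d a ≠ ⊤) :
    ∃ x y : Fin I.m → ℕ, (∀ c ∈ D, x c ≤ (I.supporters c).card) ∧ (D.map x).sum = l ∧
      (D.map y).sum = d ∧
      (D.map fun c => I.active ((I.supporters c).card - x c + y c)).sum = a ∧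
      I.h D l d a = (D.map fun c => I.mincost c (x c)).sum := by
  induction D generalizing l d a with
  | nil =>
    simp only [h] at hne ⊢
    split_ifs at hne ⊢ with h₀
    · exact ⟨0, 0, by simp, by simp [h₀.1], by simp [h₀.2.1], by simp [h₀.2.2], by simp⟩
    · exact absurd rfl hne
  | cons c D ih =>
    rw [List.nodup_cons] at hD
    simp only [h] at hne ⊢
    obtain ⟨l', hl', h₁⟩ := Finset.exists_mem_eq_inf (Finset.range (l + 1)) (by simp) fun l' =>
      (Finset.range (d + 1)).inf fun d' => (Finset.range (a + 1)).inf fun a' =>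
        I.h D l' d' a' + I.hOne c (l - l') (d - d') (a - a')
    obtain ⟨d', hd', h₂⟩ := Finset.exists_mem_eq_inf (Finset.range (d + 1)) (by simp) fun d' =>
      (Finset.range (a + 1)).inf fun a' =>
        I.h D l' d' a' + I.hOne c (l - l') (d - d') (a - a')
    obtain ⟨a', ha', h₃⟩ := Finset.exists_mem_eq_inf (Finset.range (a + 1)) (by simp) fun a' =>
        I.h D l' d' a' + I.hOne c (l - l') (d - d') (a - a')
    rw [h₁, h₂, h₃] at hne ⊢
    rw [WithTop.add_ne_top] at hne
    obtain ⟨x, y, hx, rfl, rfl, rfl, he⟩ := ih hD.2 hne.1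
    obtain ⟨hlc, hac⟩ := I.eq_active_of_hOne_ne_top hne.2
    simp only [Finset.mem_range] at hl' hd' ha'
    have hcong : ∀ {β : Type} (F : ℕ → ℕ → Fin I.m → β) (u w : ℕ),
        D.map (fun b => F (Function.update x c u b) (Function.update y c w b) b)
          = D.map fun b => F (x b) (y b) b := fun F u w =>
      List.map_congr_left fun b hb => by
        have : b ≠ c := fun h => hD.1 (h ▸ hb)
        rw [Function.update_of_ne this, Function.update_of_ne this]
    refine ⟨Function.update x c (l - (D.map x).sum), Function.update y c (d - (D.map y).sum),
      ?_, ?_, ?_, ?_, ?_⟩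
    · intro b hb
      rcases eq_or_ne b c with rfl | hbc
      · rwa [Function.update_self]
      · rw [Function.update_of_ne hbc]
        exact hx b ((List.mem_cons.1 hb).resolve_left hbc)
    · have : D.map (Function.update x c (l - (D.map x).sum)) = D.map x :=
        hcong (fun p _ _ => p) (l - (D.map x).sum) (d - (D.map y).sum)
      simp only [List.map_cons, List.sum_cons, Function.update_self]
      rw [this]
      omega
    · have : D.map (Function.update y c (d - (D.map y).sum)) = D.map y :=
        hcong (fun _ p _ => p) (l - (D.map x).sum) (d - (D.map y).sum)
      simp only [List.map_cons, List.sum_cons, Function.update_self]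
      rw [this]
      omega
    · simp only [List.map_cons, List.sum_cons, Function.update_self]
      rw [hcong (fun p q b => I.active ((I.supporters b).card - p + q)), ← hac]
      omega
    · simp only [List.map_cons, List.sum_cons, Function.update_self]
      -- The cost ignores the added votes, so the value in the second update is arbitrary.
      rw [hcong (fun p _ b => I.mincost b p) _ 0, he, add_comm]
      congr 1
      nth_rw 1 [hac]
      exact I.hOne_active c _ _

/-! ### Correctness of the algorithm in terms of plans -/

theorem algorithm_iff : I.algorithm = true ↔
    ∃ l ≤ I.n, ∃ b ≤ I.n, ∃ d ≤ I.n, ∃ a ≤ I.n, I.succeeds l b d a = true := by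
  simp [algorithm, List.any_eq_true]

theorem sum_map_sort {M : Type} [AddCommMonoid M] (s : Finset (Fin I.m)) (F : Fin I.m → M) :
    ((s.sort (· ≤ ·)).map F).sum = ∑ c ∈ s, F c := by
  rw [← List.sum_toFinset _ (Finset.sort_nodup _ _), Finset.sort_toFinset]

theorem sum_partition {M : Type} [AddCommMonoid M] (F : Fin I.m → M) :
    ∑ c, F c = F I.preferred + ∑ c ∈ I.coalition.erase I.preferred, F c
      + ∑ c ∈ I.coalitionᶜ, F c := by
  rw [Finset.add_sum_erase _ _ I.preferred_mem, Finset.sum_add_sum_compl]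

theorem exists_isPlan_of_algorithm (hI : I.algorithm = true) : ∃ v S, I.IsPlan v S := by
  obtain ⟨l, -, b, -, d, -, a, -, hs⟩ := I.algorithm_iff.1 hI
  simp only [succeeds, Bool.and_eq_true, decide_eq_true_eq] at hs
  obtain ⟨⟨⟨hB, hB'⟩, hφ⟩, hρ⟩ := hs
  obtain ⟨l', hl', hg⟩ := Finset.exists_mem_eq_inf (Finset.range (l + 1)) (by simp) fun l' =>
    I.h I.partners l' d a + I.f I.outsiders (l - l') b
  rw [Finset.mem_range] at hl'
  have hg' : I.g l b d a ≠ ⊤ := fun h => by simp [h] at hB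
  have hg'' : I.g l b d a = I.h I.partners l' d a + I.f I.outsiders (l - l') b := hg
  rw [hg'', WithTop.add_ne_top, f_eq_h] at hg'
  obtain ⟨x, y, hx, hxs, hys, has, he⟩ := I.exists_of_h_ne_top (Finset.sort_nodup _ _) hg'.1
  obtain ⟨x', y', hx', hxs', hys', has', he'⟩ := I.exists_of_h_ne_top (Finset.sort_nodup _ _) hg'.2
  rw [f_eq_h] at hg''
  unfold partners at *
  unfold outsiders at *
  rw [he, he'] at hg''
  simp only [sum_map_sort, Finset.mem_sort] at *
  set p := I.preferred with hp
  set E := I.coalition.erase p with hE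
  have hy0 : ∀ c ∈ I.coalitionᶜ, y' c = 0 := by
    simpa using hys'
  have hpE : p ∉ E := Finset.notMem_erase _ _
  have hpO : p ∉ I.coalitionᶜ := by simp [hp, I.preferred_mem]
  have hEO : ∀ c ∈ I.coalitionᶜ, c ∉ E := fun c hc h =>
    (Finset.mem_compl.1 hc) (Finset.mem_of_mem_erase h)
  -- `X` counts bribed supporters and `Y` added votes. The preferred party absorbs the imbalance: it
  -- receives `l - d` surplus votes or gives up `d - l` supporters, and truncation makes at least
  -- one of these 0.
  let X : Fin I.m → ℕ := fun c => if c = p then d - l else if c ∈ E then x c else x' c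
  let Y : Fin I.m → ℕ := fun c => if c = p then l - d else if c ∈ E then y c else 0
  have hXp : X p = d - l := by simp [X]
  have hYp : Y p = l - d := by simp [Y]
  have hXE : ∀ c ∈ E, X c = x c := fun c hc => by
    have : c ≠ p := fun h => hpE (h ▸ hc)
    simp [X, this, hc]
  have hYE : ∀ c ∈ E, Y c = y c := fun c hc => by
    have : c ≠ p := fun h => hpE (h ▸ hc)
    simp [Y, this, hc]
  have hXO : ∀ c ∈ I.coalitionᶜ, X c = x' c := fun c hc => by
    have : c ≠ p := fun h => hpO (h ▸ hc)
    simp [X, this, hEO c hc]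
  have hYO : ∀ c ∈ I.coalitionᶜ, Y c = 0 := fun c hc => by
    have : c ≠ p := fun h => hpO (h ▸ hc)
    simp [Y, this, hEO c hc]
  have hcost : ∑ c, I.mincost c (X c) ≤ I.budget := by
    rw [sum_partition, hXp, Finset.sum_congr rfl fun c hc => by rw [hXE c hc],
      Finset.sum_congr (s₁ := I.coalitionᶜ) rfl fun c hc => by rw [hXO c hc], add_assoc, ← hg'']
    rcases lt_or_ge l d with hld | hld
    · rw [add_comm]
      exact hB' hld
    · have : I.mincost p (d - l) = 0 := by simp [mincost, Nat.sub_eq_zero_of_le hld]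
      rw [this, zero_add]
      exact hB
  -- An infinite summand would break the budget, so the cost bound alone guarantees that no party,
  -- the preferred one included, loses more supporters than it has.
  have hXle : ∀ c, X c ≤ (I.supporters c).card := by
    intro c
    by_contra hc
    have htop : I.mincost c (X c) = ⊤ := by rw [mincost, if_neg hc]
    have : ∑ c, I.mincost c (X c) = ⊤ := WithTop.sum_eq_top.2 ⟨c, Finset.mem_univ _, htop⟩
    simp [this] at hcost
  choose U hU hUc hUm using fun c => I.exists_sum_eq_mincost c (hXle c)
  let v : Fin I.m → ℕ := fun c => (I.supporters c).card - X c + Y c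
  -- The removed and the added votes both total `max l d`, so the new counts sum to `n`.
  have hsX : ∑ c, X c = d - l + l := by
    rw [sum_partition, hXp, Finset.sum_congr rfl hXE, Finset.sum_congr rfl hXO, hxs, hxs']
    omega
  have hsY : ∑ c, Y c = l - d + d := by
    rw [sum_partition, hYp, Finset.sum_congr rfl hYE, Finset.sum_eq_zero hYO, hys, add_zero]
  have hvp : v p = (I.supporters p).card + l - d := by
    have := hXle p
    simp only [v, hXp, hYp] at this ⊢
    omega
  have hvE : ∑ c ∈ E, I.active (v c) = a := by
    rw [← has]
    exact Finset.sum_congr rfl fun c hc => by simp only [v, hXE c hc, hYE c hc]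
  have hvO : ∑ c ∈ I.coalitionᶜ, I.active (v c) = b := by
    rw [← has']
    exact Finset.sum_congr rfl fun c hc => by simp only [v, hXO c hc, hYO c hc, hy0 c hc]
  have hvA : ∑ c ∈ I.coalition, I.active (v c) = a + I.active (v p) := by
    rw [← Finset.add_sum_erase _ _ I.preferred_mem, ← hp, ← hE, hvE, add_comm]
  have hvC : ∑ c, I.active (v c) = a + I.active (v p) + b := by
    rw [← Finset.sum_add_sum_compl I.coalition, hvA, hvO]
  refine ⟨v, (Finset.univ.biUnion U)ᶜ, ?_, ?_, ?_, ?_⟩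
  · have h₁ : ∑ c, v c + ∑ c, X c = ∑ c, (I.supporters c).card + ∑ c, Y c := by
      rw [← Finset.sum_add_distrib, ← Finset.sum_add_distrib]
      refine Finset.sum_congr rfl fun c _ => ?_
      have := hXle c
      simp only [v]
      omega
    rw [sum_card_supporters] at h₁
    omega
  · intro c
    have : I.supporters c ∩ (Finset.univ.biUnion U)ᶜ ⊆ I.supporters c \ U c := by
      intro i hi
      simp only [Finset.mem_inter, Finset.mem_compl, Finset.mem_biUnion, Finset.mem_univ, true_and,
        not_exists, Finset.mem_sdiff] at hi ⊢
      exact ⟨hi.1, hi.2 c⟩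
    refine (Finset.card_le_card this).trans ?_
    rw [Finset.card_sdiff_of_subset (hU c), hUc]
    exact Nat.le_add_right _ _
  · rw [compl_compl, Finset.sum_biUnion, ← WithTop.coe_le_coe]
    · rw [WithTop.coe_sum, ← Finset.sum_congr rfl fun c _ => hUm c]
      exact hcost
    · intro c _ c' _ hcc
      refine Finset.disjoint_left.2 fun i hi hi' => hcc ?_
      rw [← I.mem_supporters.1 (hU c hi), ← I.mem_supporters.1 (hU c' hi')]
  · rw [MeetsTargets, hvC, hvA, ← hp, hvp]
    exact ⟨hφ, hρ⟩

/-- Outsiders are reduced to the supporters they keep in `S`, partners get exactly the votes of the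
plan, and everything else goes to the preferred party. The resulting parameters pass the tests
because this exchange only helps the coalition and the preferred party. -/
theorem algorithm_of_isPlan {v : Fin I.m → ℕ} {S : Finset (Fin I.n)} (hv : I.IsPlan v S) :
    I.algorithm = true := by
  obtain ⟨hsum, hS, hB, hφ, hρ⟩ := hv
  set p := I.preferred with hp
  set E := I.coalition.erase p with hE
  set O := I.coalitionᶜ with hO
  let κ : Fin I.m → ℕ := fun c => (I.supporters c ∩ S).card
  let X : Fin I.m → ℕ := fun c => (I.supporters c \ S).card
  let Y : Fin I.m → ℕ := fun c => v c - κ c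
  have hκ : ∀ c, κ c ≤ v c := hS
  have hκX : ∀ c, X c + κ c = (I.supporters c).card := fun c =>
    Finset.card_sdiff_add_card_inter _ _
  have hvE : ∀ c, (I.supporters c).card - X c + Y c = v c := fun c => by
    have h₁ := hκX c
    have h₂ := hκ c
    simp only [Y]
    omega
  have hvO : ∀ c, (I.supporters c).card - X c + 0 = κ c := fun c => by
    have h₁ := hκX c
    omega
  have s₁ : ∑ c ∈ E, Y c + ∑ c ∈ E, κ c = ∑ c ∈ E, v c := by
    rw [← Finset.sum_add_distrib]
    exact Finset.sum_congr rfl fun c _ => Nat.sub_add_cancel (hκ c)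
  have s₂ : ∑ c ∈ E, X c + ∑ c ∈ E, κ c = ∑ c ∈ E, (I.supporters c).card := by
    rw [← Finset.sum_add_distrib]
    exact Finset.sum_congr rfl fun c _ => hκX c
  have s₃ : ∑ c ∈ O, X c + ∑ c ∈ O, κ c = ∑ c ∈ O, (I.supporters c).card := by
    rw [← Finset.sum_add_distrib]
    exact Finset.sum_congr rfl fun c _ => hκX c
  have s₄ : ∑ c ∈ O, κ c ≤ ∑ c ∈ O, v c := Finset.sum_le_sum fun c _ => hκ c
  have s₅ := I.sum_card_supporters
  have s₆ := hsum
  rw [sum_partition] at s₅ s₆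
  simp only [← hp, ← hE, ← hO] at s₅ s₆
  have sκp := hκ p
  have sκXp := hκX p
  set l := ∑ c ∈ E, X c + ∑ c ∈ O, X c with hl
  set d := ∑ c ∈ E, Y c with hd
  set a := ∑ c ∈ E, I.active (v c) with ha
  set b := ∑ c ∈ O, I.active (κ c) with hb
  have sa : a ≤ ∑ c ∈ E, v c := Finset.sum_le_sum fun c _ => I.active_le _
  have sb : b ≤ ∑ c ∈ O, κ c := Finset.sum_le_sum fun c _ => I.active_le _
  have sb' : b ≤ ∑ c ∈ O, I.active (v c) := Finset.sum_le_sum fun c _ => I.active_mono (hκ c)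
  have hg : I.g l b d a ≤ ∑ c ∈ E, I.mincost c (X c) + ∑ c ∈ O, I.mincost c (X c) := by
    refine (Finset.inf_le (b := ∑ c ∈ E, X c) (by simp [hl])).trans ?_
    have h₁ := I.h_le I.partners X Y
    have h₂ := I.h_le I.outsiders X 0
    simp only [partners, outsiders, sum_map_sort, hvE, Pi.zero_apply, hvO,
      Finset.sum_const_zero, ← hp, ← hE, ← hO, ← hd, ← ha, ← hb] at h₁ h₂
    rw [f_eq_h, hl, Nat.add_sub_cancel_left]
    exact add_le_add h₁ h₂
  have hmin : ∀ c, I.mincost c (X c) ≤ ((∑ i ∈ I.supporters c \ S, I.price i : ℚ≥0) : WithTop ℚ≥0) :=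
    fun c => I.mincost_le c Finset.sdiff_subset
  have hgB : I.g l b d a + ((∑ i ∈ I.supporters p \ S, I.price i : ℚ≥0) : WithTop ℚ≥0)
      ≤ I.budget := by
    refine (add_le_add hg le_rfl).trans ?_
    have h₁ : ∑ c, ∑ i ∈ I.supporters c \ S, I.price i ≤ I.budget := by
      refine le_trans (le_of_eq ?_) hB
      rw [← Finset.sum_fiberwise _ I.topOf]
      refine Finset.sum_congr rfl fun c _ => Finset.sum_congr ?_ fun _ _ => rfl
      ext i
      simp [mem_supporters, and_comm]
    rw [← WithTop.coe_le_coe] at h₁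
    refine le_trans ?_ h₁
    rw [sum_partition, WithTop.coe_add, WithTop.coe_add, WithTop.coe_sum E,
      WithTop.coe_sum I.coalitionᶜ,
      add_comm, ← add_assoc]
    exact add_le_add (add_le_add le_rfl (Finset.sum_le_sum fun c _ => hmin c))
      (Finset.sum_le_sum fun c _ => hmin c)
  refine I.algorithm_iff.2 ⟨l, by omega, b, by omega, d, by omega, a, by omega, ?_⟩
  -- By counting all votes: what the plan adds to outsiders now falls to the preferred party.
  have hx : v p ≤ (I.supporters p).card + l - d := by omega
  obtain ⟨e, he⟩ := Nat.exists_eq_add_of_le (I.active_mono hx)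
  have hA : ∑ c ∈ I.coalition, I.active (v c) = a + I.active (v p) := by
    rw [← Finset.add_sum_erase _ _ I.preferred_mem, ← hp, ← hE, ha, add_comm]
  have hC : ∑ c, I.active (v c) = a + I.active (v p) + ∑ c ∈ O, I.active (v c) := by
    rw [← Finset.sum_add_sum_compl I.coalition, hA, hO]
  rw [hA, hC] at hφ
  rw [hA] at hρ
  simp only [succeeds, Bool.and_eq_true, decide_eq_true_eq, ← hp]
  have hact : (if (((I.supporters p).card + l - d : ℕ) : ℚ≥0) < I.quota then 0
      else (I.supporters p).card + l - d) = I.active (v p) + e := he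
  rw [hact]
  refine ⟨⟨⟨le_trans le_self_add hgB, fun hld => ?_⟩, ?_⟩, ?_⟩
  -- The plan itself bribes at least `d - l` supporters of the preferred party, so the cheapest `d -
  -- l` of them cost no more.
  · obtain ⟨U, hU, hUc⟩ := Finset.exists_subset_card_eq (s := I.supporters p \ S) (n := d - l)
      (by change d - l ≤ X p; omega)
    refine le_trans (add_le_add le_rfl ?_) hgB
    rw [← hUc]
    refine (I.mincost_le p (hU.trans Finset.sdiff_subset)).trans ?_
    exact WithTop.coe_le_coe.2 (Finset.sum_le_sum_of_subset hU)
  -- The gain `e` enters the right side fully and the left side with a factor of at most 1. The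
  -- ratio test below works in the same way.
  · calc I.support * ((a + (I.active (v p) + e) + b : ℕ) : ℚ≥0)
        ≤ I.support * ((a + I.active (v p) + ∑ c ∈ O, I.active (v c) : ℕ) : ℚ≥0)
          + I.support * (e : ℚ≥0) := by
          rw [← mul_add, ← Nat.cast_add]
          exact mul_le_mul_of_nonneg_left (Nat.cast_le.2 (by omega)) zero_le
      _ ≤ ((a + I.active (v p) : ℕ) : ℚ≥0) + 1 * (e : ℚ≥0) :=
          add_le_add hφ (mul_le_mul_of_nonneg_right I.support_le zero_le)
      _ = ((a + (I.active (v p) + e) : ℕ) : ℚ≥0) := by push_cast; ring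
  · calc I.ratio * ((a + (I.active (v p) + e) : ℕ) : ℚ≥0)
        = I.ratio * ((a + I.active (v p) : ℕ) : ℚ≥0) + I.ratio * (e : ℚ≥0) := by
          rw [← mul_add, ← Nat.cast_add, add_assoc]
      _ ≤ (I.active (v p) : ℚ≥0) + 1 * (e : ℚ≥0) :=
          add_le_add hρ (mul_le_mul_of_nonneg_right I.ratio_le zero_le)
      _ = ((I.active (v p) + e : ℕ) : ℚ≥0) := by push_cast; ring

theorem algorithm_iff_exists_isPlan : I.algorithm = true ↔ ∃ v S, I.IsPlan v S :=
  ⟨I.exists_isPlan_of_algorithm, fun ⟨_, _, h⟩ => I.algorithm_of_isPlan h⟩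

end Instance

/-! ### A machine program for the vote count formulation -/

namespace Expr

/-- The maximum of two expressions. -/
def max (a b : Expr) : Expr := .add a (.sub b a)

/-- The test `a ≤ b`. -/
def le (a b : Expr) : Expr := .sub (.const 1) (.sub a b)

/-- The test `a = b`. -/
def eq (a b : Expr) : Expr := .sub (.const 1) (.add (.sub a b) (.sub b a))

/-- The test `a ≠ 0`. -/
def pos (a : Expr) : Expr := .sub (.const 1) (.sub (.const 1) a)

variable (s : Memory) (a b : Expr)

@[simp] theorem eval_max : (max a b).eval s = Max.max (a.eval s) (b.eval s) := by
  simp only [max, eval]; omega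

@[simp] theorem eval_le : (le a b).eval s = if a.eval s ≤ b.eval s then 1 else 0 := by
  simp only [le, eval]; split <;> omega

@[simp] theorem eval_eq : (eq a b).eval s = if a.eval s = b.eval s then 1 else 0 := by
  simp only [eq, eval]; split <;> omega

@[simp] theorem eval_pos : (pos a).eval s = if a.eval s = 0 then 0 else 1 := by
  simp only [pos, eval]; split <;> omega

end Expr

/-! The parts of the input `w`. -/

namespace Input

variable (w : ℕ → ℕ)

/-- The top party of voter `i`. -/
def top (i : ℕ) : ℕ := w (2 + i * w 0)

/-- Membership in the coalition. -/
def member (c : ℕ) : ℕ := w (2 + w 1 * w 0 + c)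

/-- The preferred party. -/
def preferred : ℕ := w (2 + w 1 * w 0 + w 0)

/-- The numerators of the prices. -/
def num (i : ℕ) : ℕ := w (3 + w 1 * w 0 + w 0 + (i + i))

/-- The denominators of the prices. -/
def den (i : ℕ) : ℕ := w (3 + w 1 * w 0 + w 0 + (i + i) + 1)

/-- The numbers after the prices. -/
def tail (j : ℕ) : ℕ := w (3 + w 1 * w 0 + w 0 + (w 1 + w 1) + j)

/-- The prices multiplied by the product of their denominators. -/
def scaled (i : ℕ) : ℕ := num w i * ∏ j ∈ Finset.range (w 1), if j = i then 1 else den w j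

/-- The active votes of a party with `x` votes. -/
def active (x : ℕ) : ℕ := if tail w 2 * w 1 ≤ x * tail w 3 then x else 0

/-- The base of the positional encoding of a state of the dynamic program. -/
def base : ℕ := w 0 * w 1 + 1

/-- The change of the encoded state by a party `c` with `x` votes. -/
def shift (c x : ℕ) : ℕ :=
  x + active w x *
    (base w * (member w c + base w * (1 + base w * if c = preferred w then 1 else 0)))

/-- The largest total of `p i` over at most `x` of the supporters `i < k` of `c`. -/
def keep (p : ℕ → ℕ) (c : ℕ) : ℕ → ℕ → ℕ
  | 0, _ => 0
  | k + 1, x => max (keep p c k x)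
      ((keep p c k (x - 1) + p k) * ((if top w k = c then 1 else 0) * if x = 0 then 0 else 1))

end Input

namespace ForProgram

open CoalitionBribery.Expr

section Expressions

/-- The number of parties. -/
abbrev eM : Expr := .read 0 (.const 0)

/-- The number of voters. -/
abbrev eN : Expr := .read 0 (.const 1)

/-- The top party of voter `i`. -/
def eTop (i : Expr) : Expr := .read 0 (.add (.const 2) (.mul i eM))

/-- Membership in the coalition. -/
def eMember (c : Expr) : Expr := .read 0 (.add (.add (.const 2) (.mul eN eM)) c)

/-- The preferred party. -/
def ePreferred : Expr := .read 0 (.add (.add (.const 2) (.mul eN eM)) eM)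

/-- The numerators of the prices. -/
def eNum (i : Expr) : Expr :=
  .read 0 (.add (.add (.add (.const 3) (.mul eN eM)) eM) (.add i i))

/-- The denominators of the prices. -/
def eDen (i : Expr) : Expr :=
  .read 0 (.add (.add (.add (.add (.const 3) (.mul eN eM)) eM) (.add i i)) (.const 1))

/-- The numbers after the prices. -/
def eTail (j : ℕ) : Expr :=
  .read 0 (.add (.add (.add (.add (.const 3) (.mul eN eM)) eM) (.add eN eN)) (.const j))

/-- The active votes of a party. -/
def eActive (x : Expr) : Expr := .mul x (.le (.mul (eTail 2) eN) (.mul x (eTail 3)))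

/-- The base of the encoding. -/
def eBase : Expr := .add (.mul eM eN) (.const 1)

/-- The change of the encoded state. -/
def eShift (c x : Expr) : Expr :=
  .add x (.mul (eActive x) (.mul eBase (.add (eMember c)
    (.mul eBase (.add (.const 1) (.mul eBase (.eq c ePreferred)))))))

/-- The cell of the table of kept prices. -/
def eKeep (i c x : Expr) : Expr := .add (.mul (.add (.mul i eM) c) (.add eN (.const 1))) x

/-- The cell of the table of the dynamic program. -/
def eCell (x c : Expr) : Expr := .add (.mul x (.add eM (.const 1))) c

variable (s : Memory) (i c x : Expr) (j : ℕ)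

@[simp] theorem eval_eTop : (eTop i).eval s = Input.top (s 0) (i.eval s) := rfl

@[simp] theorem eval_eMember : (eMember c).eval s = Input.member (s 0) (c.eval s) := rfl

@[simp] theorem eval_ePreferred : ePreferred.eval s = Input.preferred (s 0) := rfl

@[simp] theorem eval_eNum : (eNum i).eval s = Input.num (s 0) (i.eval s) := rfl

@[simp] theorem eval_eDen : (eDen i).eval s = Input.den (s 0) (i.eval s) := rfl

@[simp] theorem eval_eTail : (eTail j).eval s = Input.tail (s 0) j := rfl

@[simp] theorem eval_eBase : eBase.eval s = Input.base (s 0) := rfl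

@[simp] theorem eval_eActive : (eActive x).eval s = Input.active (s 0) (x.eval s) := by
  change x.eval s * (le _ _).eval s = _
  rw [eval_le, Input.active, mul_ite, mul_one, mul_zero]
  rfl

@[simp] theorem eval_eShift :
    (eShift c x).eval s = Input.shift (s 0) (c.eval s) (x.eval s) := by
  simp only [eShift, Input.shift, eval, eval_eActive, eval_eBase, eval_eMember, eval_eq,
    eval_ePreferred]
  rfl

@[simp] theorem eval_eKeep :
    (eKeep i c x).eval s = (i.eval s * s 0 0 + c.eval s) * (s 0 1 + 1) + x.eval s := rfl

@[simp] theorem eval_eCell :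
    (eCell x c).eval s = x.eval s * (s 0 0 + 1) + c.eval s := rfl

end Expressions

section Parts

/-- Scale the prices (array `10`). -/
def scalePrices : ForProgram :=
  .loop 2 eN (.seq (.assign 10 (counter 2) (eNum (counter 2)))
    (.loop 3 eN (.assign 10 (counter 2) (.mul (.read 10 (counter 2))
      (.add (.mul (eDen (counter 3)) (.sub (.const 1) (.eq (counter 3) (counter 2))))
        (.eq (counter 3) (counter 2)))))))

/-- The product of the denominators (array `11`). -/
def multiplyDens : ForProgram :=
  .seq (.assign 11 (.const 0) (.const 1))
    (.loop 2 eN (.assign 11 (.const 0) (.mul (.read 11 (.const 0)) (eDen (counter 2)))))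

/-- The sum of the scaled prices (array `12`). -/
def sumPrices : ForProgram :=
  .loop 2 eN (.assign 12 (.const 0) (.add (.read 12 (.const 0)) (.read 10 (counter 2))))

/-- The table of kept prices (array `13`). -/
def tabulateKeep : ForProgram :=
  .loop 2 eN (.loop 4 eM (.loop 6 (.add eN (.const 1))
    (.assign 13 (eKeep (.add (counter 2) (.const 1)) (counter 4) (counter 6))
      (.max (.read 13 (eKeep (counter 2) (counter 4) (counter 6)))
        (.mul (.add (.read 13 (eKeep (counter 2) (counter 4) (.sub (counter 6) (.const 1))))
            (.read 10 (counter 2)))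
          (.mul (.eq (eTop (counter 2)) (counter 4)) (.pos (counter 6))))))))

/-- The table of the dynamic program over the parties (array `14`): `0` stands for an unreachable
state, `k + 1` for the kept price `k`. -/
def tabulateBest : ForProgram :=
  .seq (.assign 14 (.const 0) (.const 1))
    (.loop 4 eM (.loop 5 (.mul (.mul (.mul eBase eBase) eBase) eBase)
      (.loop 6 (.add eN (.const 1))
        (.assign 14 (eCell (.add (counter 5) (eShift (counter 4) (counter 6)))
            (.add (counter 4) (.const 1)))
          (.max (.read 14 (eCell (.add (counter 5) (eShift (counter 4) (counter 6)))
              (.add (counter 4) (.const 1))))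
            (.mul (.add (.read 14 (eCell (counter 5) (counter 4)))
                (.read 13 (eKeep eN (counter 4) (counter 6))))
              (.pos (.read 14 (eCell (counter 5) (counter 4))))))))))

/-- The final entry for the active votes of the coalition, of all parties and of the preferred
party in arrays `2`, `3` and `4`. -/
def eEntry : Expr :=
  .read 14 (eCell (.add (.mul (.add (.mul (.add (.mul (counter 4) eBase) (counter 3)) eBase)
    (counter 2)) eBase) eN) eM)

/-- Compare the final entries with the budget and the targets. -/
def findBest : ForProgram :=
  .loop 2 (.add eN (.const 1)) (.loop 3 (.add eN (.const 1)) (.loop 4 (.add eN (.const 1))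
    (.assign 1 (.const 0) (.max (.read 1 (.const 0))
      (.mul (.mul (.mul (.pos eEntry)
        (.le (.add (.mul (.read 12 (.const 0)) (eTail 1)) (eTail 1))
          (.add (.mul (.read 11 (.const 0)) (eTail 0)) (.mul eEntry (eTail 1)))))
        (.le (.mul (counter 3) (eTail 4)) (.mul (counter 2) (eTail 5))))
        (.le (.mul (counter 2) (eTail 6)) (.mul (counter 4) (eTail 7))))))))

/-- The program. -/
def main : ForProgram :=
  .seq scalePrices (.seq multiplyDens (.seq sumPrices (.seq tabulateKeep
    (.seq tabulateBest findBest))))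

/-- The condition is decidable syntax, so the time analysis of the program ends here. -/
theorem isPoly_main : main.isPoly = true := by decide

end Parts

/-! ### Loop invariants for the scaled and the kept prices -/

section Semantics

theorem set_apply_same (s : Memory) (a i v : ℕ) : s.set a i v a = Function.update (s a) i v := by
  funext j
  simp [Memory.set, Function.update_apply]

theorem set_apply_of_ne (s : Memory) {a b : ℕ} (i v : ℕ) (h : b ≠ a) : s.set a i v b = s b := by
  funext j
  simp [Memory.set, h]

/-- The invariant rule for a loop, for an invariant on a single array `a`. -/
theorem loop_induction {k : ℕ} {e : Expr} {p : ForProgram} {s : Memory} (a : ℕ) (hak : a ≠ k)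
    (hk : p.writes k = false) (Inv : ℕ → (ℕ → ℕ) → Prop) (h0 : Inv 0 (s a))
    (hstep : ∀ i s', i < e.eval s → s' k 0 = i →
      (∀ b, b ≠ k → p.writes b = false → s' b = s b) → Inv i (s' a) → Inv (i + 1) (p.exec s' a)) :
    Inv (e.eval s) ((loop k e p).exec s a) := by
  have key : ∀ N ≤ e.eval s,
      (fun s' : Memory => s' k 0 = N ∧ (∀ b, b ≠ k → p.writes b = false → s' b = s b) ∧
        Inv N (s' a)) ((fun s => (p.exec s).set k 0 (p.exec s k 0 + 1))^[N] (s.set k 0 0)) := by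
    intro N
    induction N with
    | zero =>
      intro _
      refine ⟨by simp [Memory.set], fun b hb _ => set_apply_of_ne _ _ _ hb, ?_⟩
      simpa [set_apply_of_ne _ _ _ hak] using h0
    | succ N ih =>
      intro hN
      obtain ⟨h₁, h₂, h₃⟩ := ih (by omega)
      rw [Function.iterate_succ_apply']
      generalize (fun s => (p.exec s).set k 0 (p.exec s k 0 + 1))^[N] (s.set k 0 0) = s' at *
      refine ⟨?_, fun b hb hw => ?_, ?_⟩
      · simp [Memory.set, exec_apply_of_not_writes p s' hk, h₁]
      · rw [set_apply_of_ne _ _ _ hb, exec_apply_of_not_writes p s' hw, h₂ b hb hw]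
      · rw [set_apply_of_ne _ _ _ hak]
        exact hstep N s' (by omega) h₁ h₂ h₃
  exact (key _ le_rfl).2.2

theorem exec_scalePrices (s : Memory) {i : ℕ} (hi : i < s 0 1) :
    scalePrices.exec s 10 i = Input.scaled (s 0) i := by
  refine loop_induction 10 (by decide) (by decide)
    (fun N A => ∀ i < N, A i = Input.scaled (s 0) i) (by simp) ?_ i hi
  intro k s₁ hk hc hf hinv i hi
  have h0 : s₁ 0 = s 0 := hf 0 (by decide) (by decide)
  set s₂ := (assign 10 (counter 2) (eNum (counter 2))).exec s₁ with hs₂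
  have h20 : s₂ 0 = s 0 := (exec_apply_of_not_writes _ _ (by decide)).trans h0
  have h22 : s₂ 2 = s₁ 2 := exec_apply_of_not_writes _ _ (by decide)
  have hA : s₂ 10 = Function.update (s₁ 10) k (Input.num (s 0) k) := by
    simp only [hs₂, exec, set_apply_same, eval_eNum, h0, eval, hc]
  have inner := loop_induction (k := 3) (e := eN) (s := s₂)
    (p := .assign 10 (counter 2) (.mul (.read 10 (counter 2))
      (.add (.mul (eDen (counter 3)) (.sub (.const 1) (.eq (counter 3) (counter 2))))
        (.eq (counter 3) (counter 2))))) 10 (by decide) (by decide)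
    (fun N A => A = Function.update (s₁ 10) k
      (Input.num (s 0) k * ∏ j ∈ Finset.range N, if j = k then 1 else Input.den (s 0) j))
    (by simp [hA]) (by
      intro j s₃ hj hcj hf₃ hinv₃
      have h30 : s₃ 0 = s 0 := (hf₃ 0 (by decide) (by decide)).trans h20
      have h32 : s₃ 2 0 = k := by
        rw [hf₃ 2 (by decide) (by decide), h22, hc]
      simp only [exec, set_apply_same, eval, eval_eDen, eval_eq, h30, h32, hcj, hinv₃,
        Function.update_idem, Function.update_self, Finset.prod_range_succ, mul_assoc]
      -- The factor `den * (1 - eq) + eq` skips the voter's own denominator without a branch.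
      by_cases hjk : j = k <;> simp [hjk])
  have hN : eN.eval s₂ = s 0 1 := by simp [eval, h20]
  rw [hN] at inner
  change (loop 3 eN _).exec s₂ 10 i = _
  rw [inner]
  rcases eq_or_ne i k with rfl | hik
  · rw [Function.update_self, Input.scaled]
  · rw [Function.update_of_ne hik]
    exact hinv i (by omega)

theorem exec_multiplyDens (s : Memory) :
    multiplyDens.exec s 11 0 = ∏ j ∈ Finset.range (s 0 1), Input.den (s 0) j := by
  set s₁ := (assign 11 (.const 0) (.const 1)).exec s with hs₁
  have h10 : s₁ 0 = s 0 := exec_apply_of_not_writes _ _ (by decide)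
  have h := loop_induction (k := 2) (e := eN) (s := s₁)
    (p := .assign 11 (.const 0) (.mul (.read 11 (.const 0)) (eDen (counter 2)))) 11
    (by decide) (by decide)
    (fun N A => A 0 = ∏ j ∈ Finset.range N, Input.den (s 0) j)
    (by simp [hs₁, exec, Memory.set, eval]) (by
      intro j s₃ hj hcj hf₃ hinv₃
      have h30 : s₃ 0 = s 0 := (hf₃ 0 (by decide) (by decide)).trans h10
      simp [exec, Memory.set, eval, Finset.prod_range_succ, h30, hinv₃, hcj])
  have hN : eN.eval s₁ = s 0 1 := by simp [eval, h10]
  rwa [hN] at h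

theorem exec_sumPrices (s : Memory) (hs : s 12 0 = 0) :
    sumPrices.exec s 12 0 = ∑ j ∈ Finset.range (s 0 1), s 10 j := by
  refine loop_induction 12 (by decide) (by decide)
    (fun N A => A 0 = ∑ j ∈ Finset.range N, s 10 j) (by simpa using hs) ?_
  intro j s₁ hj hcj hf hinv
  have h0 : s₁ 10 = s 10 := hf 10 (by decide) (by decide)
  simp [exec, Memory.set, eval, Finset.sum_range_succ, h0, hinv, hcj]

/-- Used both to tell table cells apart and to read off the digits of an encoded state. -/
theorem mul_add_inj {k a b a' b' : ℕ} (hb : b < k) (hb' : b' < k) (h : a * k + b = a' * k + b') :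
    a = a' ∧ b = b' := by
  have hk : 0 < k := by omega
  have h₁ := congrArg (· / k) h
  simp only [Nat.mul_comm _ k, Nat.mul_add_div hk, Nat.div_eq_of_lt hb, Nat.div_eq_of_lt hb',
    add_zero] at h₁
  subst h₁
  exact ⟨rfl, by omega⟩

/-- The entries are filled in the lexicographic order of `(i, c, x)`, and those for `i + 1` read
only entries for `i`, which are complete. The three nested invariants record this order. -/
theorem exec_tabulateKeep (s : Memory) (hs : s 13 = 0) {c x : ℕ} (hc : c < s 0 0)
    (hx : x < s 0 1 + 1) :
    tabulateKeep.exec s 13 ((s 0 1 * s 0 0 + c) * (s 0 1 + 1) + x) =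
      Input.keep (s 0) (s 10) c (s 0 1) x := by
  set w := s 0 with hw
  refine loop_induction (k := 2) (e := eN) 13 (by decide) (by decide)
    (fun N A => ∀ i ≤ N, ∀ c < w 0, ∀ x < w 1 + 1, A ((i * w 0 + c) * (w 1 + 1) + x) =
      Input.keep w (s 10) c i x) ?_ ?_ (w 1) le_rfl c hc x hx
  · intro i hi c _ x _
    obtain rfl : i = 0 := by omega
    simp [hs, Input.keep]
  intro i s₁ hi hci hf hinv
  have h10 : s₁ 0 = w := hf 0 (by decide) (by decide)
  have h110 : s₁ 10 = s 10 := hf 10 (by decide) (by decide)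
  have middle := loop_induction (k := 4) (e := eM) (s := s₁)
    (p := .loop 6 (.add eN (.const 1))
      (.assign 13 (eKeep (.add (counter 2) (.const 1)) (counter 4) (counter 6))
      (.max (.read 13 (eKeep (counter 2) (counter 4) (counter 6)))
        (.mul (.add (.read 13 (eKeep (counter 2) (counter 4) (.sub (counter 6) (.const 1))))
            (.read 10 (counter 2)))
          (.mul (.eq (eTop (counter 2)) (counter 4)) (.pos (counter 6))))))) 13
    (by decide) (by decide)
    (fun N A => ∀ i' c x, c < w 0 → x < w 1 + 1 → (i' ≤ i ∨ i' = i + 1 ∧ c < N) →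
      A ((i' * w 0 + c) * (w 1 + 1) + x) = Input.keep w (s 10) c i' x)
    (by
      intro i' c x hc hx h
      exact hinv i' (by omega) c hc x hx) (by
    intro c s₂ hc hcc hf₂ hinv₂
    have h20 : s₂ 0 = w := (hf₂ 0 (by decide) (by decide)).trans h10
    have h210 : s₂ 10 = s 10 := (hf₂ 10 (by decide) (by decide)).trans h110
    have h22 : s₂ 2 0 = i := by rw [hf₂ 2 (by decide) (by decide), hci]
    have hcm : c < w 0 := by simpa [eval, h10] using hc
    have inner := loop_induction (k := 6) (e := .add eN (.const 1)) (s := s₂)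
      (p := .assign 13 (eKeep (.add (counter 2) (.const 1)) (counter 4) (counter 6))
        (.max (.read 13 (eKeep (counter 2) (counter 4) (counter 6)))
          (.mul (.add (.read 13 (eKeep (counter 2) (counter 4) (.sub (counter 6) (.const 1))))
              (.read 10 (counter 2)))
            (.mul (.eq (eTop (counter 2)) (counter 4)) (.pos (counter 6)))))) 13
      (by decide) (by decide)
      (fun N A => ∀ i' c' x, c' < w 0 → x < w 1 + 1 →
        (i' ≤ i ∨ i' = i + 1 ∧ (c' < c ∨ c' = c ∧ x < N)) →
        A ((i' * w 0 + c') * (w 1 + 1) + x) = Input.keep w (s 10) c' i' x)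
      (by
        intro i' c' x hc' hx h
        exact hinv₂ i' c' x hc' hx (by omega)) (by
      intro x s₃ hx hcx hf₃ hinv₃ i' c' x' hc' hx' h
      have h30 : s₃ 0 = w := (hf₃ 0 (by decide) (by decide)).trans h20
      have h310 : s₃ 10 = s 10 := (hf₃ 10 (by decide) (by decide)).trans h210
      have h32 : s₃ 2 0 = i := by rw [hf₃ 2 (by decide) (by decide), h22]
      have h34 : s₃ 4 0 = c := by rw [hf₃ 4 (by decide) (by decide), hcc]
      have hxn : x < w 1 + 1 := by simpa [eval, h20] using hx
      simp only [exec, set_apply_same, eval_eKeep, eval_max, eval, eval_eq, eval_pos, eval_eTop,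
        h30, h310, h32, h34, hcx]
      by_cases heq : (i' * w 0 + c') * (w 1 + 1) + x' = ((i + 1) * w 0 + c) * (w 1 + 1) + x
      · obtain ⟨h₁, rfl⟩ := mul_add_inj hx' hxn heq
        obtain ⟨rfl, rfl⟩ := mul_add_inj hc' hcm h₁
        -- For `x' = 0` the index `x' - 1` is again 0, a valid cell; the factor testing `x' ≠ 0`
        -- discards what is read there.
        rw [Function.update_self, hinv₃ i c' x' hcm hxn (Or.inl le_rfl),
          hinv₃ i c' (x' - 1) hcm (by omega) (Or.inl le_rfl), Input.keep]
      · rw [Function.update_of_ne heq]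
        refine hinv₃ i' c' x' hc' hx' ?_
        by_contra hcon
        apply heq
        obtain ⟨rfl, rfl, rfl⟩ : i' = i + 1 ∧ c' = c ∧ x' = x := by omega
        rfl)
    have hN : (Expr.add eN (.const 1)).eval s₂ = w 1 + 1 := by simp [eval, h20]
    rw [hN] at inner
    intro i' c' x hc' hx h
    exact inner i' c' x hc' hx (by omega))
  have hN : eM.eval s₁ = w 0 := by simp [eval, h10]
  rw [hN] at middle
  intro i' hi' c hc x hx
  exact middle i' c x hc hx (by omega)

end Semantics

end ForProgram

namespace ForProgram

open CoalitionBribery.Expr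

/-! ### The table over the parties -/

section BestTable

variable {m n : ℕ} (δ κ : ℕ → ℕ → ℕ)

/-- Every entry of the table is attained by vote counts of the first parties. -/
def Attained (m n : ℕ) (A : ℕ → ℕ) : Prop :=
  ∀ c ≤ m, ∀ x, A (x * (m + 1) + c) ≠ 0 → ∃ v : ℕ → ℕ, (∀ j < c, v j ≤ n) ∧
    ∑ j ∈ Finset.range c, δ j (v j) = x ∧
    A (x * (m + 1) + c) = ∑ j ∈ Finset.range c, κ j (v j) + 1

/-- The table accounts for the choice of `v` votes for party `c` in state `x`. -/
def Relaxed (m : ℕ) (A : ℕ → ℕ) (c x v : ℕ) : Prop :=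
  A (x * (m + 1) + c) ≠ 0 →
    A (x * (m + 1) + c) + κ c v ≤ A ((x + δ c v) * (m + 1) + (c + 1))

/-- The state of the table after the choices in `Done`. -/
structure Progress (m n : ℕ) (Done : ℕ → ℕ → ℕ → Prop) (A : ℕ → ℕ) : Prop where
  attained : Attained δ κ m n A
  start : A 0 = 1
  relaxed : ∀ c x v, Done c x v → Relaxed δ κ m A c x v

variable {δ κ}

theorem Progress.mono {Done Done' : ℕ → ℕ → ℕ → Prop} {A : ℕ → ℕ}
    (h : Progress δ κ m n Done A) (hD : ∀ c x v, Done' c x v → Done c x v) :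
    Progress δ κ m n Done' A :=
  ⟨h.attained, h.start, fun c x v hd => h.relaxed c x v (hD c x v hd)⟩

/-- The write goes to column `c + 1` and its source is in column `c`. Columns up to `c` stay fixed
and entries only increase, so earlier relaxations remain valid; a new entry is attained by extending
the witness of its source by `v`. -/
theorem Progress.update {Done Done' : ℕ → ℕ → ℕ → Prop} {A : ℕ → ℕ}
    (h : Progress δ κ m n Done A) {c x v : ℕ} (hc : c < m) (hv : v ≤ n)
    (hle : ∀ c' x' v', Done c' x' v' → c' ≤ c)
    (hD : ∀ c' x' v', Done' c' x' v' → Done c' x' v' ∨ c' = c ∧ x' = x ∧ v' = v) :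
    Progress δ κ m n Done' (Function.update A ((x + δ c v) * (m + 1) + (c + 1))
      (max (A ((x + δ c v) * (m + 1) + (c + 1)))
        ((A (x * (m + 1) + c) + κ c v) * if A (x * (m + 1) + c) = 0 then 0 else 1))) := by
  set I := (x + δ c v) * (m + 1) + (c + 1) with hI
  set V := max (A I) ((A (x * (m + 1) + c) + κ c v) * if A (x * (m + 1) + c) = 0 then 0 else 1)
    with hV
  have hmono : ∀ i, A i ≤ Function.update A I V i := fun i => by
    rcases eq_or_ne i I with rfl | hi
    · rw [Function.update_self]
      exact le_max_left _ _
    · rw [Function.update_of_ne hi]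
  have hother : ∀ x' c', c' ≤ c → Function.update A I V (x' * (m + 1) + c') =
      A (x' * (m + 1) + c') := fun x' c' hc' => by
    refine Function.update_of_ne (fun heq => ?_) _ _
    have := (mul_add_inj (by omega) (by omega) heq).2
    omega
  refine ⟨?_, ?_, ?_⟩
  · intro c' hc' x' hne
    by_cases heq : x' * (m + 1) + c' = I
    · obtain ⟨rfl, rfl⟩ := mul_add_inj (by omega) (by omega) heq
      rw [Function.update_self] at hne ⊢
      rcases max_choice (A I)
        ((A (x * (m + 1) + c) + κ c v) * if A (x * (m + 1) + c) = 0 then 0 else 1) with hm | hm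
      · rw [hV, hm] at hne ⊢
        exact h.attained (c + 1) hc' _ hne
      · rw [hV, hm] at hne ⊢
        have h0 : A (x * (m + 1) + c) ≠ 0 := fun h0 => by simp [h0] at hne
        rw [if_neg h0, mul_one]
        obtain ⟨u, hu, hx, hA⟩ := h.attained c (by omega) x h0
        have hcong : ∀ F : ℕ → ℕ → ℕ, ∑ j ∈ Finset.range c, F j (Function.update u c v j)
            = ∑ j ∈ Finset.range c, F j (u j) := fun F => Finset.sum_congr rfl fun j hj => by
          rw [Function.update_of_ne (Finset.mem_range.1 hj).ne]
        refine ⟨Function.update u c v, fun j hj => ?_, ?_, ?_⟩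
        · rcases eq_or_ne j c with rfl | hjc
          · rwa [Function.update_self]
          · rw [Function.update_of_ne hjc]
            exact hu j (by omega)
        · rw [Finset.sum_range_succ, hcong, hx, Function.update_self]
        · rw [Finset.sum_range_succ, hcong, hA, Function.update_self]
          omega
    · rw [Function.update_of_ne heq] at hne ⊢
      exact h.attained c' hc' x' hne
  · simpa only [Nat.zero_mul, Nat.add_zero, h.start] using hother 0 0 (Nat.zero_le _)
  · intro c' x' v' hd hne
    rcases hD c' x' v' hd with hd | ⟨rfl, rfl, rfl⟩
    · rw [hother x' c' (hle _ _ _ hd)] at hne ⊢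
      exact (h.relaxed c' x' v' hd hne).trans (hmono _)
    · rw [hother x' c' le_rfl] at hne ⊢
      rw [← hI, Function.update_self, hV, if_neg hne, mul_one]
      exact le_max_right _ _

/-- Only the states on the path of `v`, its partial sums, have to be covered by `Done`. -/
theorem Progress.le_of_sum {Done : ℕ → ℕ → ℕ → Prop} {A : ℕ → ℕ}
    (h : Progress δ κ m n Done A) (v : ℕ → ℕ)
    (hD : ∀ c < m, Done c (∑ j ∈ Finset.range c, δ j (v j)) (v c)) {c : ℕ} (hc : c ≤ m) :
    ∑ j ∈ Finset.range c, κ j (v j) + 1 ≤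
      A ((∑ j ∈ Finset.range c, δ j (v j)) * (m + 1) + c) := by
  induction c with
  | zero => simp [h.start]
  | succ c ih =>
    have ih := ih (by omega)
    have := h.relaxed _ _ _ (hD c (by omega)) (by omega)
    rw [Finset.sum_range_succ, Finset.sum_range_succ]
    omega

end BestTable

/-- When party `c` is treated, column `c` is final. Sources are restricted to encodable states,
while targets may lie beyond them without harm, since `Attained` puts no bound on the state. -/
theorem exec_tabulateBest (s : Memory) (hs : s 14 = 0) :
    Progress (Input.shift (s 0)) (fun c x => s 13 ((s 0 1 * s 0 0 + c) * (s 0 1 + 1) + x))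
      (s 0 0) (s 0 1)
      (fun c x v => c < s 0 0 ∧ x < Input.base (s 0) * Input.base (s 0) * Input.base (s 0) *
        Input.base (s 0) ∧ v < s 0 1 + 1) (tabulateBest.exec s 14) := by
  set s₁ := (assign 14 (.const 0) (.const 1)).exec s with hs₁
  have h10 : s₁ 0 = s 0 := exec_apply_of_not_writes _ _ (by decide)
  have h113 : s₁ 13 = s 13 := exec_apply_of_not_writes _ _ (by decide)
  have hA : s₁ 14 = Function.update (0 : ℕ → ℕ) 0 1 := by
    simp only [hs₁, exec, set_apply_same, eval, hs]
  set w := s 0 with hw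
  set δ := Input.shift w with hδ
  set κ : ℕ → ℕ → ℕ := fun c x => s 13 ((w 1 * w 0 + c) * (w 1 + 1) + x) with hκ
  set X := Input.base w * Input.base w * Input.base w * Input.base w with hX
  have outer := loop_induction (k := 4) (e := eM) (s := s₁)
    (p := .loop 5 (.mul (.mul (.mul eBase eBase) eBase) eBase)
      (.loop 6 (.add eN (.const 1))
        (.assign 14 (eCell (.add (counter 5) (eShift (counter 4) (counter 6)))
            (.add (counter 4) (.const 1)))
          (.max (.read 14 (eCell (.add (counter 5) (eShift (counter 4) (counter 6)))
              (.add (counter 4) (.const 1))))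
            (.mul (.add (.read 14 (eCell (counter 5) (counter 4)))
                (.read 13 (eKeep eN (counter 4) (counter 6))))
              (.pos (.read 14 (eCell (counter 5) (counter 4)))))))))
    14 (by decide) (by decide)
    (fun N A => Progress δ κ (w 0) (w 1) (fun c x v => c < N ∧ x < X ∧ v < w 1 + 1) A)
    (by
      refine ⟨fun c hc x hne => ?_, by simp [hA], by omega⟩
      rw [hA] at hne ⊢
      -- The only nonzero cell at the start belongs to state 0 with no parties treated.
      have h0 : x * (w 0 + 1) + c = 0 := by
        by_contra h
        rw [Function.update_of_ne h] at hne
        exact hne rfl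
      obtain ⟨rfl, rfl⟩ := mul_add_inj (k := w 0 + 1) (b := c) (a' := 0) (b' := 0) (by omega) (by omega)
        (by simpa using h0)
      exact ⟨0, by simp, by simp, by simp⟩) (by
    intro c s₂ hc hcc hf₂ hinv₂
    have h20 : s₂ 0 = w := (hf₂ 0 (by decide) (by decide)).trans h10
    have h213 : s₂ 13 = s 13 := (hf₂ 13 (by decide) (by decide)).trans h113
    have hcm : c < w 0 := by simpa [eval, h10] using hc
    have middle := loop_induction (k := 5) (e := .mul (.mul (.mul eBase eBase) eBase) eBase)
      (s := s₂)
      (p := .loop 6 (.add eN (.const 1))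
        (.assign 14 (eCell (.add (counter 5) (eShift (counter 4) (counter 6)))
            (.add (counter 4) (.const 1)))
          (.max (.read 14 (eCell (.add (counter 5) (eShift (counter 4) (counter 6)))
              (.add (counter 4) (.const 1))))
            (.mul (.add (.read 14 (eCell (counter 5) (counter 4)))
                (.read 13 (eKeep eN (counter 4) (counter 6))))
              (.pos (.read 14 (eCell (counter 5) (counter 4))))))))
      14 (by decide) (by decide)
      (fun N A => Progress δ κ (w 0) (w 1) (fun c' x v => x < X ∧ v < w 1 + 1 ∧
        (c' < c ∨ c' = c ∧ x < N)) A)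
      (hinv₂.mono (by omega)) (by
      intro x s₃ hx hcx hf₃ hinv₃
      have h30 : s₃ 0 = w := (hf₃ 0 (by decide) (by decide)).trans h20
      have h313 : s₃ 13 = s 13 := (hf₃ 13 (by decide) (by decide)).trans h213
      have h34 : s₃ 4 0 = c := by rw [hf₃ 4 (by decide) (by decide), hcc]
      have inner := loop_induction (k := 6) (e := .add eN (.const 1)) (s := s₃)
        (p := .assign 14 (eCell (.add (counter 5) (eShift (counter 4) (counter 6)))
            (.add (counter 4) (.const 1)))
          (.max (.read 14 (eCell (.add (counter 5) (eShift (counter 4) (counter 6)))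
              (.add (counter 4) (.const 1))))
            (.mul (.add (.read 14 (eCell (counter 5) (counter 4)))
                (.read 13 (eKeep eN (counter 4) (counter 6))))
              (.pos (.read 14 (eCell (counter 5) (counter 4)))))))
        14 (by decide) (by decide)
        (fun N A => Progress δ κ (w 0) (w 1) (fun c' x' v => x' < X ∧ v < w 1 + 1 ∧
          (c' < c ∨ c' = c ∧ (x' < x ∨ x' = x ∧ v < N))) A)
        (hinv₃.mono (by omega)) (by
        intro v s₄ hv hcv hf₄ hinv₄
        have h40 : s₄ 0 = w := (hf₄ 0 (by decide) (by decide)).trans h30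
        have h413 : s₄ 13 = s 13 := (hf₄ 13 (by decide) (by decide)).trans h313
        have h44 : s₄ 4 0 = c := by rw [hf₄ 4 (by decide) (by decide), h34]
        have h45 : s₄ 5 0 = x := by rw [hf₄ 5 (by decide) (by decide), hcx]
        have hvn : v < w 1 + 1 := by simpa [eval, h30] using hv
        have hup := hinv₄.update (x := x) (v := v) hcm (by omega) (by omega)
          (Done' := fun c' x' v' => x' < X ∧ v' < w 1 + 1 ∧
            (c' < c ∨ c' = c ∧ (x' < x ∨ x' = x ∧ v' < v + 1))) (by omega)
        simpa only [exec, set_apply_same, eval_eCell, eval_eKeep, eval_max, eval, eval_pos,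
          eval_eShift, h40, h413, h44, h45, hcv] using hup)
      have hN : (Expr.add eN (.const 1)).eval s₃ = w 1 + 1 := by simp [eval, h30]
      rw [hN] at inner
      exact inner.mono (by omega))
    have hN : (Expr.mul (.mul (.mul eBase eBase) eBase) eBase).eval s₂ = X := by
      simp [eval, h20, hX]
    rw [hN] at middle
    exact middle.mono (by omega))
  have hN : eM.eval s₁ = w 0 := by simp [eval, h10]
  rw [hN] at outer
  exact outer

/-! ### The search through the final entries -/

section Search

variable (w A : ℕ → ℕ) (D T : ℕ)

/-- The cell of the final entry for given active votes. -/
def entryCell (α β γ : ℕ) : ℕ :=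
  (((γ * Input.base w + β) * Input.base w + α) * Input.base w + w 1) * (w 0 + 1) + w 0

/-- The final test. -/
def Passes (α β γ : ℕ) : Prop :=
  A (entryCell w α β γ) ≠ 0 ∧
    T * Input.tail w 1 + Input.tail w 1 ≤ D * Input.tail w 0 +
      A (entryCell w α β γ) * Input.tail w 1 ∧
    β * Input.tail w 4 ≤ α * Input.tail w 5 ∧ α * Input.tail w 6 ≤ γ * Input.tail w 7

/-- The output reflects the tests in `Done`. -/
def Reflects (Done : ℕ → ℕ → ℕ → Prop) (B : ℕ → ℕ) : Prop :=
  B 0 ≤ 1 ∧ (B 0 ≠ 0 ↔ ∃ α β γ, Done α β γ ∧ Passes w A D T α β γ)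

variable {w A D T}

theorem Reflects.congr {Done Done' : ℕ → ℕ → ℕ → Prop} {B : ℕ → ℕ}
    (h : Reflects w A D T Done B) (hD : ∀ α β γ, Done' α β γ ↔ Done α β γ) :
    Reflects w A D T Done' B :=
  ⟨h.1, by simpa only [hD] using h.2⟩

theorem Reflects.update {Done Done' : ℕ → ℕ → ℕ → Prop} {B : ℕ → ℕ} {x α β γ : ℕ}
    (h : Reflects w A D T Done B) (hx : x ≤ 1) (hx' : x ≠ 0 ↔ Passes w A D T α β γ)
    (hD : ∀ α' β' γ', Done' α' β' γ' ↔ Done α' β' γ' ∨ α' = α ∧ β' = β ∧ γ' = γ) :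
    Reflects w A D T Done' (Function.update B 0 (max (B 0) x)) := by
  rw [Reflects, Function.update_self]
  refine ⟨max_le h.1 hx, ?_⟩
  have : max (B 0) x ≠ 0 ↔ B 0 ≠ 0 ∨ x ≠ 0 := by omega
  rw [this, h.2, hx']
  constructor
  · rintro (⟨a, b, c, hd, hp⟩ | hp)
    · exact ⟨a, b, c, (hD _ _ _).2 (Or.inl hd), hp⟩
    · exact ⟨α, β, γ, (hD _ _ _).2 (Or.inr ⟨rfl, rfl, rfl⟩), hp⟩
  · rintro ⟨a, b, c, hd, hp⟩
    rcases (hD _ _ _).1 hd with hd | ⟨rfl, rfl, rfl⟩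
    · exact Or.inl ⟨a, b, c, hd, hp⟩
    · exact Or.inr hp

end Search

theorem eval_eEntry (s : Memory) :
    eEntry.eval s = s 14 (entryCell (s 0) (s 2 0) (s 3 0) (s 4 0)) := rfl

theorem exec_findBest (s : Memory) (hs : s 1 0 = 0) :
    Reflects (s 0) (s 14) (s 11 0) (s 12 0)
      (fun α β γ => α < s 0 1 + 1 ∧ β < s 0 1 + 1 ∧ γ < s 0 1 + 1) (findBest.exec s 1) := by
  set w := s 0 with hw
  have hN : (Expr.add eN (.const 1)).eval s = w 1 + 1 := rfl
  rw [← hN]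
  refine loop_induction (k := 2) (e := .add eN (.const 1)) (s := s) 1 (by decide) (by decide)
    (fun N B => Reflects w (s 14) (s 11 0) (s 12 0) (fun α β γ => α < N ∧
      β < (Expr.add eN (.const 1)).eval s ∧ γ < (Expr.add eN (.const 1)).eval s) B)
    ⟨by omega, by simp [hs]⟩ ?_
  rw [hN]
  intro α s₁ hα hcα hf₁ hinv₁
  have h10 : s₁ 0 = w := hf₁ 0 (by decide) (by decide)
  have middle := loop_induction (k := 3) (e := .add eN (.const 1)) (s := s₁)
    (p := .loop 4 (.add eN (.const 1))
      (.assign 1 (.const 0) (.max (.read 1 (.const 0))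
        (.mul (.mul (.mul (.pos eEntry)
          (.le (.add (.mul (.read 12 (.const 0)) (eTail 1)) (eTail 1))
            (.add (.mul (.read 11 (.const 0)) (eTail 0)) (.mul eEntry (eTail 1)))))
          (.le (.mul (counter 3) (eTail 4)) (.mul (counter 2) (eTail 5))))
          (.le (.mul (counter 2) (eTail 6)) (.mul (counter 4) (eTail 7)))))))
    1 (by decide) (by decide)
    (fun N B => Reflects w (s 14) (s 11 0) (s 12 0) (fun α' β γ =>
      β < w 1 + 1 ∧ γ < w 1 + 1 ∧ (α' < α ∨ α' = α ∧ β < N)) B)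
    (hinv₁.congr (by omega)) (by
    intro β s₂ hβ hcβ hf₂ hinv₂
    have h20 : s₂ 0 = w := (hf₂ 0 (by decide) (by decide)).trans h10
    have h22 : s₂ 2 0 = α := by rw [hf₂ 2 (by decide) (by decide), hcα]
    have hβn : β < w 1 + 1 := by simpa [eval, h10] using hβ
    have inner := loop_induction (k := 4) (e := .add eN (.const 1)) (s := s₂)
      (p := .assign 1 (.const 0) (.max (.read 1 (.const 0))
        (.mul (.mul (.mul (.pos eEntry)
          (.le (.add (.mul (.read 12 (.const 0)) (eTail 1)) (eTail 1))
            (.add (.mul (.read 11 (.const 0)) (eTail 0)) (.mul eEntry (eTail 1)))))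
          (.le (.mul (counter 3) (eTail 4)) (.mul (counter 2) (eTail 5))))
          (.le (.mul (counter 2) (eTail 6)) (.mul (counter 4) (eTail 7))))))
      1 (by decide) (by decide)
      (fun N B => Reflects w (s 14) (s 11 0) (s 12 0) (fun α' β' γ =>
        β' < w 1 + 1 ∧ γ < w 1 + 1 ∧ (α' < α ∨ α' = α ∧ (β' < β ∨ β' = β ∧ γ < N))) B)
      (hinv₂.congr (by omega)) (by
      intro γ s₃ hγ hcγ hf₃ hinv₃
      have frame : ∀ b, b ∉ [1, 2, 3, 4] → s₃ b = s b := fun b hb => by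
        simp only [List.mem_cons, List.not_mem_nil, or_false, not_or] at hb
        rw [hf₃ b hb.2.2.2 (by simp [writes, hb]), hf₂ b hb.2.2.1 (by simp [writes, hb]),
          hf₁ b hb.2.1 (by simp [writes, hb])]
      have h30 : s₃ 0 = w := frame 0 (by decide)
      have h311 : s₃ 11 = s 11 := frame 11 (by decide)
      have h312 : s₃ 12 = s 12 := frame 12 (by decide)
      have h314 : s₃ 14 = s 14 := frame 14 (by decide)
      have h32 : s₃ 2 0 = α := by rw [hf₃ 2 (by decide) (by decide), h22]
      have h33 : s₃ 3 0 = β := by rw [hf₃ 3 (by decide) (by decide), hcβ]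
      have hγn : γ < w 1 + 1 := by simpa [eval, h20] using hγ
      simp only [exec, set_apply_same, eval_max, eval]
      refine hinv₃.update (α := α) (β := β) (γ := γ) ?_ ?_ (by omega)
      · simp only [eval_pos, eval_le]
        split_ifs <;> simp
      · rw [mul_ne_zero_iff, mul_ne_zero_iff, mul_ne_zero_iff]
        simp only [eval_pos, eval_le, ne_eq, ite_eq_right_iff, ite_eq_left_iff, one_ne_zero,
          imp_false, not_not, eval_eEntry, eval, eval_eTail, h30, h311, h312, h314,
          h32, h33, hcγ, Passes, and_assoc])
    have hN₂ : (Expr.add eN (.const 1)).eval s₂ = w 1 + 1 := by simp [eval, h20]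
    rw [hN₂] at inner
    exact inner.congr (by omega))
  have hN₁ : (Expr.add eN (.const 1)).eval s₁ = w 1 + 1 := by simp [eval, h10]
  rw [hN₁] at middle
  exact middle.congr (by omega)

/-- The question that the program answers. -/
def Solvable (w : ℕ → ℕ) : Prop :=
  ∃ v : ℕ → ℕ, ∑ c ∈ Finset.range (w 0), v c = w 1 ∧
    (∑ i ∈ Finset.range (w 1), Input.scaled w i) * Input.tail w 1 ≤
      (∏ i ∈ Finset.range (w 1), Input.den w i) * Input.tail w 0 +
        (∑ c ∈ Finset.range (w 0), Input.keep w (Input.scaled w) c (w 1) (v c)) *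
          Input.tail w 1 ∧
    (∑ c ∈ Finset.range (w 0), Input.active w (v c)) * Input.tail w 4 ≤
      (∑ c ∈ Finset.range (w 0), Input.active w (v c) * Input.member w c) * Input.tail w 5 ∧
    (∑ c ∈ Finset.range (w 0), Input.active w (v c) * Input.member w c) * Input.tail w 6 ≤
      Input.active w (v (Input.preferred w)) * Input.tail w 7

theorem active_le (w : ℕ → ℕ) (x : ℕ) : Input.active w x ≤ x := by
  unfold Input.active
  split <;> omega

/-- The encoded state is additive over the parties. From the lowest digit up it holds all votes, the
active votes of the coalition, those of all parties and those of the preferred party. -/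
theorem sum_shift (w v : ℕ → ℕ) (c : ℕ) :
    ∑ j ∈ Finset.range c, Input.shift w j (v j) =
      (((∑ j ∈ Finset.range c, Input.active w (v j) * if j = Input.preferred w then 1 else 0) *
        Input.base w + ∑ j ∈ Finset.range c, Input.active w (v j)) * Input.base w +
        ∑ j ∈ Finset.range c, Input.active w (v j) * Input.member w j) * Input.base w +
        ∑ j ∈ Finset.range c, v j := by
  simp only [Finset.sum_mul, ← Finset.sum_add_distrib, Input.shift]
  exact Finset.sum_congr rfl fun j _ => by ring

theorem sum_active_pref (w v : ℕ → ℕ) (hp : Input.preferred w < w 0) :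
    (∑ j ∈ Finset.range (w 0), Input.active w (v j) * if j = Input.preferred w then 1 else 0) =
      Input.active w (v (Input.preferred w)) := by
  simp [hp]

/-- Needed because the array of scaled prices is only known at indices of voters. -/
theorem keep_congr (w : ℕ → ℕ) {p q : ℕ → ℕ} (c : ℕ) {k : ℕ} (h : ∀ i < k, p i = q i) (x : ℕ) :
    Input.keep w p c k x = Input.keep w q c k x := by
  induction k generalizing x with
  | zero => rfl
  | succ k ih =>
    simp only [Input.keep]
    rw [ih (fun i hi => h i (by omega)), ih (fun i hi => h i (by omega)), h k (by omega)]

/-- A final entry that passes is attained by some `v`, whose sums are the digits of its cell.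
Conversely, a solution `v` leads to a cell whose entry is at least its kept price plus one, and a
larger entry can only help in the budget test. -/
theorem exec_main (w : ℕ → ℕ) (hp : Input.preferred w < w 0)
    (hmem : ∀ c < w 0, Input.member w c ≤ 1) :
    main.exec (fun a i => if a = 0 then w i else 0) 1 0 ≤ 1 ∧
      (main.exec (fun a i => if a = 0 then w i else 0) 1 0 ≠ 0 ↔ Solvable w) := by
  set s₀ : Memory := fun a i => if a = 0 then w i else 0 with hs₀
  have hz : ∀ a, a ≠ 0 → s₀ a = 0 := fun a ha => by
    funext i
    simp [hs₀, ha]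
  have hw : s₀ 0 = w := by
    funext i
    simp [hs₀]
  set s₁ := scalePrices.exec s₀ with hs₁
  set s₂ := multiplyDens.exec s₁ with hs₂
  set s₃ := sumPrices.exec s₂ with hs₃
  set s₄ := tabulateKeep.exec s₃ with hs₄
  set s₅ := tabulateBest.exec s₄ with hs₅
  have hmain : main.exec s₀ = findBest.exec s₅ := rfl
  have f₁ : ∀ b, scalePrices.writes b = false → s₁ b = s₀ b :=
    fun b hb => exec_apply_of_not_writes _ _ hb
  have f₂ : ∀ b, multiplyDens.writes b = false → s₂ b = s₁ b :=
    fun b hb => exec_apply_of_not_writes _ _ hb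
  have f₃ : ∀ b, sumPrices.writes b = false → s₃ b = s₂ b :=
    fun b hb => exec_apply_of_not_writes _ _ hb
  have f₄ : ∀ b, tabulateKeep.writes b = false → s₄ b = s₃ b :=
    fun b hb => exec_apply_of_not_writes _ _ hb
  have f₅ : ∀ b, tabulateBest.writes b = false → s₅ b = s₄ b :=
    fun b hb => exec_apply_of_not_writes _ _ hb
  have w₁ : s₁ 0 = w := (f₁ 0 (by decide)).trans hw
  have w₂ : s₂ 0 = w := (f₂ 0 (by decide)).trans w₁
  have w₃ : s₃ 0 = w := (f₃ 0 (by decide)).trans w₂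
  have w₄ : s₄ 0 = w := (f₄ 0 (by decide)).trans w₃
  have w₅ : s₅ 0 = w := (f₅ 0 (by decide)).trans w₄
  have hQ : ∀ i < w 1, s₁ 10 i = Input.scaled w i := fun i hi => by
    rw [hs₁, exec_scalePrices s₀ (by rwa [hw]), hw]
  have hQ₂ : s₂ 10 = s₁ 10 := f₂ 10 (by decide)
  have hQ₃ : s₃ 10 = s₁ 10 := (f₃ 10 (by decide)).trans hQ₂
  have hD : s₅ 11 0 = ∏ i ∈ Finset.range (w 1), Input.den w i := by
    rw [f₅ 11 (by decide), f₄ 11 (by decide), f₃ 11 (by decide), hs₂, exec_multiplyDens, w₁]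
  have hT : s₅ 12 0 = ∑ i ∈ Finset.range (w 1), Input.scaled w i := by
    rw [f₅ 12 (by decide), f₄ 12 (by decide), hs₃, exec_sumPrices, w₂, hQ₂]
    · exact Finset.sum_congr rfl fun i hi => hQ i (Finset.mem_range.1 hi)
    · rw [f₂ 12 (by decide), f₁ 12 (by decide), hz 12 (by decide)]
      rfl
  have hK : ∀ c < w 0, ∀ x < w 1 + 1, s₄ 13 ((w 1 * w 0 + c) * (w 1 + 1) + x) =
      Input.keep w (Input.scaled w) c (w 1) x := by
    intro c hc x hx
    have h := exec_tabulateKeep s₃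
      (by rw [f₃ 13 (by decide), f₂ 13 (by decide), f₁ 13 (by decide), hz 13 (by decide)])
      (c := c) (x := x) (by rwa [w₃]) (by rwa [w₃])
    rw [w₃, hQ₃] at h
    rw [hs₄, h]
    exact keep_congr w c hQ x
  have hB := exec_tabulateBest s₄ (by
    rw [f₄ 14 (by decide), f₃ 14 (by decide), f₂ 14 (by decide), f₁ 14 (by decide),
      hz 14 (by decide)])
  rw [w₄, ← hs₅] at hB
  have hF := exec_findBest s₅ (by
    rw [f₅ 1 (by decide), f₄ 1 (by decide), f₃ 1 (by decide), f₂ 1 (by decide), f₁ 1 (by decide),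
      hz 1 (by decide)]
    rfl)
  rw [w₅, hD, hT, ← hmain] at hF
  refine ⟨hF.1, hF.2.trans ?_⟩
  have hn : w 1 < Input.base w := by
    unfold Input.base
    have : 1 * w 1 ≤ w 0 * w 1 := Nat.mul_le_mul_right _ (by omega)
    omega
  -- The table allows up to `n` votes for every party separately, so partial sums can reach `m * n`;
  -- hence the base `m * n + 1`.
  have hbound : ∀ (v : ℕ → ℕ), (∀ j < w 0, v j ≤ w 1) → ∀ c ≤ w 0,
      ∑ j ∈ Finset.range c, v j < Input.base w := by
    intro v hv c hc
    calc ∑ j ∈ Finset.range c, v j ≤ ∑ j ∈ Finset.range c, w 1 :=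
          Finset.sum_le_sum fun j hj => hv j (by rw [Finset.mem_range] at hj; omega)
      _ = c * w 1 := by simp
      _ ≤ w 0 * w 1 := Nat.mul_le_mul_right _ hc
      _ < Input.base w := Nat.lt_succ_self _
  have hmul : ∀ (x b : ℕ), b ≤ 1 → Input.active w x * b ≤ x := fun x b hb =>
    (Nat.mul_le_mul (active_le w x) hb).trans (by simp)
  have hcell : ∀ v : ℕ → ℕ, (∀ j < w 0, v j ≤ w 1) → ∀ c ≤ w 0,
      ∑ j ∈ Finset.range c, v j < Input.base w ∧
      ∑ j ∈ Finset.range c, Input.active w (v j) * Input.member w j < Input.base w ∧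
      ∑ j ∈ Finset.range c, Input.active w (v j) < Input.base w ∧
      (∑ j ∈ Finset.range c, Input.active w (v j) * if j = Input.preferred w then 1 else 0)
        < Input.base w := by
    intro v hv c hc
    refine ⟨hbound v hv c hc, hbound _ (fun j hj => ?_) c hc, hbound _ (fun j hj => ?_) c hc,
      hbound _ (fun j hj => ?_) c hc⟩
    · exact (hmul _ _ (hmem j hj)).trans (hv j hj)
    · exact (active_le w _).trans (hv j hj)
    · exact (hmul _ _ (by split <;> simp)).trans (hv j hj)
  constructor
  · rintro ⟨α, β, γ, ⟨hα, hβ, hγ⟩, hne, h₁, h₂, h₃⟩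
    obtain ⟨v, hv, hsum, hval⟩ := hB.attained (w 0) le_rfl _ hne
    rw [entryCell, hval] at h₁
    obtain ⟨c₁, c₂, c₃, -⟩ := hcell v hv (w 0) le_rfl
    rw [sum_shift] at hsum
    -- The lowest digit of the entry is `n`, which selects the counts with the right total. The
    -- topmost digit needs no bound.
    obtain ⟨hsum, e₁⟩ := mul_add_inj c₁ hn hsum
    obtain ⟨hsum, e₂⟩ := mul_add_inj c₂ (by omega) hsum
    obtain ⟨e₄, e₃⟩ := mul_add_inj c₃ (by omega) hsum
    rw [sum_active_pref w v hp] at e₄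
    refine ⟨v, e₁, ?_, by rwa [e₂, e₃], by rwa [e₂, e₄]⟩
    -- Entries exceed the kept price by one, to distinguish price 0 from an unreachable state; the
    -- additional denominator on the left of the budget test cancels this.
    rw [Finset.sum_congr rfl fun c hc => hK c (Finset.mem_range.1 hc) (v c)
      (Nat.lt_succ_of_le (hv c (Finset.mem_range.1 hc))), add_mul, one_mul] at h₁
    omega
  · rintro ⟨v, hsum, h₁, h₂, h₃⟩
    have hv : ∀ j < w 0, v j ≤ w 1 := fun j hj => by
      rw [← hsum]
      exact Finset.single_le_sum (f := v) (fun _ _ => Nat.zero_le _) (Finset.mem_range.2 hj)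
    have hle := hB.le_of_sum v (fun c hc => ⟨hc, by
      obtain ⟨c₁, c₂, c₃, c₄⟩ := hcell v hv c hc.le
      rw [sum_shift]
      have step : ∀ {a b k l : ℕ}, a < l → b < k → a * k + b < l * k := by
        intro a b k l ha hb
        calc a * k + b < a * k + k := by omega
          _ = (a + 1) * k := by ring
          _ ≤ l * k := Nat.mul_le_mul_right _ ha
      exact step (step (step c₄ c₃) c₂) c₁, Nat.lt_succ_of_le (hv c hc)⟩) le_rfl
    rw [sum_shift, sum_active_pref w v hp, hsum] at hle
    rw [Finset.sum_congr rfl fun c hc => hK c (Finset.mem_range.1 hc) (v c)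
      (Nat.lt_succ_of_le (hv c (Finset.mem_range.1 hc)))] at hle
    have hA : ∑ j ∈ Finset.range (w 0), Input.active w (v j) * Input.member w j ≤ w 1 := by
      rw [← hsum]
      exact Finset.sum_le_sum fun j hj => hmul _ _ (hmem j (Finset.mem_range.1 hj))
    have hC : ∑ j ∈ Finset.range (w 0), Input.active w (v j) ≤ w 1 := by
      rw [← hsum]
      exact Finset.sum_le_sum fun j _ => active_le w _
    have hG : Input.active w (v (Input.preferred w)) ≤ w 1 := (active_le w _).trans (hv _ hp)
    refine ⟨_, _, _, ⟨Nat.lt_succ_of_le hA, Nat.lt_succ_of_le hC, Nat.lt_succ_of_le hG⟩,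
      Nat.pos_iff_ne_zero.1 (lt_of_lt_of_le (Nat.succ_pos _) hle), ?_, h₂, h₃⟩
    have := Nat.mul_le_mul_right (Input.tail w 1) hle
    rw [add_mul, one_mul] at this
    rw [entryCell]
    omega

end ForProgram

/-! ### The input of the program -/

theorem getD_flatMap {α : Type} (F : α → List ℕ) {k j : ℕ} (hF : ∀ a, (F a).length = k)
    (hj : j < k) (l : List α) {i : ℕ} (hi : i < l.length) :
    (l.flatMap F).getD (i * k + j) 0 = (F l[i]).getD j 0 := by
  induction l generalizing i with
  | nil => simp at hi
  | cons a l ih =>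
    rw [List.flatMap_cons]
    cases i with
    | zero =>
      rw [List.getD_append _ _ _ _ (by rw [hF]; omega)]
      simp
    | succ i =>
      have hidx : (i + 1) * k + j = k + (i * k + j) := by ring
      rw [List.getD_append_right _ _ _ _ (by rw [hF, hidx]; omega), hF, hidx,
        Nat.add_sub_cancel_left, ih (by simpa using hi)]
      simp

theorem length_flatMap_const {α : Type} (F : α → List ℕ) {k : ℕ} (hF : ∀ a, (F a).length = k)
    (l : List α) : (l.flatMap F).length = l.length * k := by
  simp [List.length_flatMap, hF]

/-- Induction on the last voter `k`: if it lies in `S`, removing it frees one of the `x` places.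
With the converse below, `keep` is a maximum. -/
theorem sum_le_keep (w p : ℕ → ℕ) (c : ℕ) {k x : ℕ} {S : Finset ℕ} (hS : S ⊆ Finset.range k)
    (htop : ∀ i ∈ S, Input.top w i = c) (hx : S.card ≤ x) :
    ∑ i ∈ S, p i ≤ Input.keep w p c k x := by
  induction k generalizing S x with
  | zero =>
    have : S = ∅ := by simpa using hS
    simp [this]
  | succ k ih =>
    rw [Input.keep]
    by_cases hk : k ∈ S
    · refine le_trans ?_ (le_max_right _ _)
      have hcard := Finset.card_erase_add_one hk
      rw [if_pos (htop k hk), if_neg (by omega), mul_one, mul_one, ← Finset.sum_erase_add _ _ hk]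
      refine Nat.add_le_add_right (ih (fun i hi => ?_) (fun i hi => ?_) (by omega)) _
      · have h₁ := Finset.mem_range.1 (hS (Finset.mem_of_mem_erase hi))
        have h₂ := Finset.ne_of_mem_erase hi
        exact Finset.mem_range.2 (by omega)
      · exact htop i (Finset.mem_of_mem_erase hi)
    · refine le_trans (ih (fun i hi => ?_) htop hx) (le_max_left _ _)
      have h₁ := Finset.mem_range.1 (hS hi)
      have h₂ : i ≠ k := fun h => hk (h ▸ hi)
      exact Finset.mem_range.2 (by omega)

theorem exists_sum_eq_keep (w p : ℕ → ℕ) (c k x : ℕ) :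
    ∃ S ⊆ Finset.range k, (∀ i ∈ S, Input.top w i = c) ∧ S.card ≤ x ∧
      ∑ i ∈ S, p i = Input.keep w p c k x := by
  induction k generalizing x with
  | zero => exact ⟨∅, by simp [Input.keep]⟩
  | succ k ih =>
    have hle : Finset.range k ⊆ Finset.range (k + 1) := Finset.range_mono (Nat.le_succ k)
    obtain ⟨S, hS, htop, hx, hsum⟩ := ih x
    rw [Input.keep]
    by_cases h : Input.top w k = c ∧ x ≠ 0
    · rw [if_pos h.1, if_neg h.2, mul_one, mul_one]
      rcases max_choice (Input.keep w p c k x) (Input.keep w p c k (x - 1) + p k) with hm | hm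
      · exact ⟨S, hS.trans hle, htop, hx, by rw [hm, hsum]⟩
      · obtain ⟨S', hS', htop', hx', hsum'⟩ := ih (x - 1)
        have hk : k ∉ S' := fun hk => by simpa using hS' hk
        refine ⟨insert k S', ?_, ?_, ?_, ?_⟩
        · exact Finset.insert_subset (by simp) (hS'.trans hle)
        · intro i hi
          rcases Finset.mem_insert.1 hi with rfl | hi
          exacts [h.1, htop' i hi]
        · rw [Finset.card_insert_of_notMem hk]
          omega
        · rw [Finset.sum_insert hk, hm, hsum', add_comm]
    · refine ⟨S, hS.trans hle, htop, hx, ?_⟩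
      have : ((if Input.top w k = c then 1 else 0) * if x = 0 then 0 else 1) = 0 := by
        by_cases h₁ : Input.top w k = c
        · have : x = 0 := by
            by_contra h₂
            exact h ⟨h₁, h₂⟩
          simp [this]
        · simp [h₁]
      rw [this, mul_zero, hsum]
      simp

theorem mul_num_le_mul_den_iff (q : ℚ≥0) (a b : ℕ) :
    a * q.num ≤ b * q.den ↔ q * (a : ℚ≥0) ≤ (b : ℚ≥0) := by
  have hd : (0 : ℚ≥0) < (q.den : ℚ≥0) := Nat.cast_pos.2 q.den_pos
  rw [← Nat.cast_le (α := ℚ≥0), Nat.cast_mul, Nat.cast_mul, ← NNRat.mul_den_eq_num, ← mul_assoc,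
    mul_le_mul_iff_left₀ hd, mul_comm]

/-! ### Decoding the input, and agreement of program and algorithm -/

namespace Instance

variable (I : Instance)

/-- The contents of the input array. -/
def input (i : ℕ) : ℕ := I.encode.getD i 0

/-- The ballots as a list. -/
def ballots : List ℕ := (List.finRange I.n).flatMap
  fun i => (List.finRange I.m).map fun k => (((I.order i).symm k : Fin I.m) : ℕ)

/-- The coalition as a list. -/
def members : List ℕ := (List.finRange I.m).map (fun c => if c ∈ I.coalition then 1 else 0)

/-- The prices as a list. -/
def prices : List ℕ := (List.finRange I.n).flatMap (fun i => encodeRat (I.price i))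

/-- The last part of the input. -/
def trailer : List ℕ :=
  encodeRat I.budget ++ encodeRat I.threshold ++ encodeRat I.support ++ encodeRat I.ratio

theorem encode_eq : I.encode =
    [I.m, I.n] ++ (I.ballots ++ (I.members ++ ([(I.preferred : ℕ)] ++ (I.prices ++ I.trailer)))) := by
  simp only [encode, ballots, members, prices, trailer, List.append_assoc]

theorem length_ballots : I.ballots.length = I.n * I.m := by
  rw [ballots, length_flatMap_const _ (k := I.m) (by simp), List.length_finRange]

theorem length_members : I.members.length = I.m := by simp [members]

theorem length_prices : I.prices.length = I.n * 2 := by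
  rw [prices, length_flatMap_const _ (k := 2) (by simp [encodeRat]), List.length_finRange]

theorem getD_append_add (l l' : List ℕ) {k : ℕ} (hk : l.length = k) (i : ℕ) :
    (l ++ l').getD (k + i) 0 = l'.getD i 0 := by
  rw [List.getD_append_right _ _ _ _ (by omega), hk, Nat.add_sub_cancel_left]

theorem input_zero : I.input 0 = I.m := rfl

theorem input_one : I.input 1 = I.n := rfl

theorem input_two_add (i : ℕ) : I.input (2 + i) =
    (I.ballots ++ (I.members ++ ([(I.preferred : ℕ)] ++ (I.prices ++ I.trailer)))).getD i 0 := by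
  rw [input, encode_eq, getD_append_add [I.m, I.n] _ (k := 2) rfl]

theorem top_input (i : Fin I.n) : Input.top I.input i = I.topOf i := by
  have hm : 0 < I.m := I.preferred.pos
  have hi : (i : ℕ) * I.m + 0 < I.n * I.m :=
    Nat.mul_lt_mul_of_pos_right i.isLt hm
  rw [Input.top, input_zero, input_two_add, List.getD_append _ _ _ _ (by rwa [length_ballots]),
    ← Nat.add_zero ((i : ℕ) * I.m), ballots,
    getD_flatMap _ (k := I.m) (by simp) hm _ (by simp)]
  simp [topOf, top, hm]

theorem member_input (c : Fin I.m) :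
    Input.member I.input c = if c ∈ I.coalition then 1 else 0 := by
  rw [Input.member, input_zero, input_one, add_assoc, input_two_add,
    getD_append_add _ _ I.length_ballots,
    List.getD_append _ _ _ _ (by rw [length_members]; exact c.isLt)]
  simp [members]

theorem preferred_input : Input.preferred I.input = I.preferred := by
  rw [Input.preferred, input_zero, input_one, add_assoc, input_two_add,
    getD_append_add _ _ I.length_ballots, List.getD_append_right _ _ _ _ I.length_members.le,
    length_members]
  simp

theorem input_three_add (i : ℕ) :
    I.input (3 + I.n * I.m + I.m + i) = (I.prices ++ I.trailer).getD i 0 := by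
  have : 3 + I.n * I.m + I.m + i = 2 + (I.n * I.m + (I.m + (1 + i))) := by ring
  rw [this, input_two_add, getD_append_add _ _ I.length_ballots,
    getD_append_add _ _ I.length_members, getD_append_add [(I.preferred : ℕ)] _ (k := 1) rfl]

theorem num_input (i : Fin I.n) : Input.num I.input i = (I.price i).num := by
  have h : (i : ℕ) + i = i * 2 + 0 := by ring
  rw [Input.num, input_zero, input_one, input_three_add, h, List.getD_append _ _ _ _
    (by rw [length_prices]; omega), prices,
    getD_flatMap _ (k := 2) (by simp [encodeRat]) (by omega) _ (by simp)]
  simp [encodeRat]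

theorem den_input (i : Fin I.n) : Input.den I.input i = (I.price i).den := by
  have h : (i : ℕ) + i + 1 = i * 2 + 1 := by ring
  rw [Input.den, input_zero, input_one, add_assoc, input_three_add, h, List.getD_append _ _ _ _
    (by rw [length_prices]; omega), prices,
    getD_flatMap _ (k := 2) (by simp [encodeRat]) (by omega) _ (by simp)]
  simp [encodeRat]

theorem tail_input (j : ℕ) : Input.tail I.input j = I.trailer.getD j 0 := by
  have h : I.n + I.n = I.n * 2 := by ring
  rw [Input.tail, input_zero, input_one, add_assoc, input_three_add, h,
    getD_append_add _ _ I.length_prices]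

theorem active_input (x : ℕ) : Input.active I.input x = I.active x := by
  have h₂ : I.trailer.getD 2 0 = I.threshold.num := rfl
  have h₃ : I.trailer.getD 3 0 = I.threshold.den := rfl
  rw [Input.active, active, tail_input, tail_input, input_one, h₂, h₃, mul_comm I.threshold.num]
  by_cases h : (x : ℚ≥0) < I.quota
  · rw [if_pos h, if_neg fun h' => not_le.2 h ((mul_num_le_mul_den_iff _ _ _).1 h')]
  · rw [if_neg h, if_pos ((mul_num_le_mul_den_iff _ _ _).2 (not_lt.1 h))]

/-- The product of the denominators of the prices. -/
def commonDen : ℕ := ∏ i ∈ Finset.range I.n, Input.den I.input i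

theorem commonDen_pos : 0 < I.commonDen :=
  Finset.prod_pos fun i hi => by
    rw [I.den_input ⟨i, Finset.mem_range.1 hi⟩]
    exact NNRat.den_pos _

/-- The scaled price omits the voter's own denominator from the product, which is the factor that
turns the price into its numerator. -/
theorem scaled_input (i : Fin I.n) :
    (Input.scaled I.input i : ℚ≥0) = I.commonDen * I.price i := by
  have hi : (i : ℕ) ∈ Finset.range I.n := Finset.mem_range.2 i.isLt
  have h : (I.commonDen : ℚ≥0) = (I.price i).den *
      ((∏ j ∈ Finset.range I.n, if j = (i : ℕ) then 1 else Input.den I.input j : ℕ) : ℚ≥0) := by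
    rw [← Nat.cast_mul, ← den_input, commonDen, ← Finset.mul_prod_erase _ _ hi,
      ← Finset.mul_prod_erase _ (fun j => if j = (i : ℕ) then 1 else Input.den I.input j) hi,
      if_pos rfl, one_mul]
    congr 2
    exact Finset.prod_congr rfl fun j hj => by rw [if_neg (Finset.ne_of_mem_erase hj)]
  rw [Input.scaled, num_input, input_one, Nat.cast_mul, h, mul_right_comm,
    mul_comm (((I.price i).den : ℕ) : ℚ≥0), NNRat.mul_den_eq_num]

theorem sum_price_le_budget_iff (S : Finset (Fin I.n)) :
    ∑ i ∈ S, I.price i ≤ I.budget ↔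
      (∑ i ∈ S, Input.scaled I.input i) * I.budget.den ≤ I.commonDen * I.budget.num := by
  have hD : (0 : ℚ≥0) < (I.commonDen : ℚ≥0) := Nat.cast_pos.2 I.commonDen_pos
  have hd : (0 : ℚ≥0) < (I.budget.den : ℚ≥0) := Nat.cast_pos.2 I.budget.den_pos
  rw [← Nat.cast_le (α := ℚ≥0), Nat.cast_mul, Nat.cast_mul, Nat.cast_sum,
    Finset.sum_congr rfl fun i _ => I.scaled_input i, ← Finset.mul_sum, mul_assoc,
    mul_le_mul_iff_right₀ hD, ← NNRat.mul_den_eq_num, mul_le_mul_iff_left₀ hd]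

theorem meetsTargets_input (v : ℕ → ℕ) :
    I.MeetsTargets (fun c => v c) ↔
      (∑ c ∈ Finset.range I.m, Input.active I.input (v c)) * Input.tail I.input 4 ≤
        (∑ c ∈ Finset.range I.m, Input.active I.input (v c) * Input.member I.input c) *
          Input.tail I.input 5 ∧
      (∑ c ∈ Finset.range I.m, Input.active I.input (v c) * Input.member I.input c) *
          Input.tail I.input 6 ≤
        Input.active I.input (v (Input.preferred I.input)) * Input.tail I.input 7 := by
  have h₄ : I.trailer.getD 4 0 = I.support.num := rfl
  have h₅ : I.trailer.getD 5 0 = I.support.den := rfl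
  have h₆ : I.trailer.getD 6 0 = I.ratio.num := rfl
  have h₇ : I.trailer.getD 7 0 = I.ratio.den := rfl
  have hA : ∑ c ∈ Finset.range I.m, Input.active I.input (v c) * Input.member I.input c =
      ∑ c ∈ I.coalition, I.active (v c) := by
    rw [Finset.sum_range]
    simp only [member_input, active_input, mul_ite, mul_one, mul_zero]
    rw [Finset.sum_ite_mem, Finset.univ_inter]
  rw [hA, Finset.sum_range, tail_input, tail_input, tail_input, tail_input, h₄, h₅, h₆, h₇,
    mul_num_le_mul_den_iff, mul_num_le_mul_den_iff, preferred_input]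
  simp only [active_input, MeetsTargets]

/-- Paying for the bribed voters within the budget means that the total price minus the kept price
is within it. For given counts the kept supporters are chosen for each party independently, so the
maximal kept prices add up. -/
theorem solvable_iff : ForProgram.Solvable I.input ↔ ∃ v S, I.IsPlan v S := by
  have hB : Input.tail I.input 0 = I.budget.num := I.tail_input 0
  have hB' : Input.tail I.input 1 = I.budget.den := I.tail_input 1
  have hsplit : ∀ S : Finset (Fin I.n),
      ∑ i ∈ Finset.range I.n, Input.scaled I.input i =
        ∑ i ∈ S, Input.scaled I.input i + ∑ i ∈ Sᶜ, Input.scaled I.input i := fun S => by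
    rw [Finset.sum_range, Finset.sum_add_sum_compl]
  have hfiber : ∀ S : Finset (Fin I.n), ∑ i ∈ S, Input.scaled I.input i =
      ∑ c, ∑ i ∈ I.supporters c ∩ S, Input.scaled I.input i := fun S => by
    rw [← Finset.sum_fiberwise _ I.topOf]
    refine Finset.sum_congr rfl fun c _ => Finset.sum_congr ?_ fun _ _ => rfl
    ext i
    simp [mem_supporters, and_comm]
  rw [ForProgram.Solvable, input_zero, input_one, hB, hB', ← commonDen]
  constructor
  · rintro ⟨v, hsum, hcost, htargets⟩
    rw [Finset.sum_range] at hsum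
    choose K hK htop hcard hval using fun c =>
      exists_sum_eq_keep I.input (Input.scaled I.input) c I.n (v c)
    -- As `K c` consists of supporters of `c`, this set meets the supporters of each party `c` in
    -- exactly `K c`.
    let S : Finset (Fin I.n) := Finset.univ.filter fun i => (i : ℕ) ∈ K (I.topOf i)
    have hS : ∀ c : Fin I.m, (I.supporters c ∩ S).map Fin.valEmbedding = K c := by
      intro c
      ext j
      simp only [Finset.mem_map, Finset.mem_inter, mem_supporters, S, Finset.mem_filter,
        Finset.mem_univ, true_and, Fin.valEmbedding_apply]
      constructor
      · rintro ⟨i, ⟨rfl, hi⟩, rfl⟩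
        exact hi
      · intro hj
        have hjn := Finset.mem_range.1 (hK c hj)
        have ht := htop c j hj
        rw [I.top_input ⟨j, hjn⟩] at ht
        have ht' : I.topOf ⟨j, hjn⟩ = c := Fin.ext ht
        exact ⟨⟨j, hjn⟩, ⟨ht', by rwa [ht']⟩, rfl⟩
    have hkeep : ∑ i ∈ S, Input.scaled I.input i = ∑ c ∈ Finset.range I.m,
        Input.keep I.input (Input.scaled I.input) c I.n (v c) := by
      rw [hfiber, Finset.sum_range]
      refine Finset.sum_congr rfl fun c _ => ?_
      rw [← hval, ← hS c, Finset.sum_map]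
      rfl
    refine ⟨fun c => v c, S, hsum, fun c => ?_, ?_, (I.meetsTargets_input v).2 htargets⟩
    · rw [← Finset.card_map Fin.valEmbedding, hS c]
      exact hcard c
    · rw [sum_price_le_budget_iff]
      rw [hsplit S, ← hkeep, add_mul] at hcost
      omega
  · rintro ⟨v, S, hsum, hS, hcost, htargets⟩
    let v' : ℕ → ℕ := fun c => if h : c < I.m then v ⟨c, h⟩ else 0
    have hv' : ∀ c : Fin I.m, v' c = v c := fun c => by simp [v']
    have hv : (fun c : Fin I.m => v' c) = v := funext hv'
    refine ⟨v', ?_, ?_, (I.meetsTargets_input v').1 (by rwa [hv])⟩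
    · rw [Finset.sum_range, ← hsum]
      exact Finset.sum_congr rfl fun c _ => hv' c
    · have hkeep : ∑ i ∈ S, Input.scaled I.input i ≤ ∑ c ∈ Finset.range I.m,
          Input.keep I.input (Input.scaled I.input) c I.n (v' c) := by
        rw [hfiber, Finset.sum_range]
        refine Finset.sum_le_sum fun c _ => ?_
        have := sum_le_keep I.input (Input.scaled I.input) c (k := I.n) (x := v' c)
          (S := (I.supporters c ∩ S).map Fin.valEmbedding)
          (fun j hj => by
            obtain ⟨i, -, rfl⟩ := Finset.mem_map.1 hj
            exact Finset.mem_range.2 i.isLt)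
          (fun j hj => by
            obtain ⟨i, hi, rfl⟩ := Finset.mem_map.1 hj
            exact (I.top_input i).trans
              (congrArg Fin.val (I.mem_supporters.1 (Finset.mem_inter.1 hi).1)))
          (by rw [Finset.card_map, hv']; exact hS c)
        rwa [Finset.sum_map] at this
      rw [sum_price_le_budget_iff] at hcost
      have := Nat.mul_le_mul_right I.budget.den hkeep
      rw [hsplit S, add_mul]
      omega

/-- In binary, a number can be exponentially larger than its length. Here the coalition vector has
an entry for every party and the price list two for every voter, which keeps the loop bounds
polynomial. -/
theorem length_encode : I.m + I.n ≤ I.encode.length := by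
  rw [encode_eq]
  simp only [List.length_append, length_ballots, length_members, length_prices]
  omega

/-- Program and algorithm both decide whether a plan exists, so they agree although their tables
differ. -/
theorem exec_main_encode : ForProgram.main.exec (initial I.encode) 1 0 = I.algorithm.toNat := by
  obtain ⟨h₁, h₂⟩ := ForProgram.exec_main I.input
    (by rw [preferred_input, input_zero]; exact I.preferred.isLt)
    (fun c hc => by
      rw [input_zero] at hc
      rw [I.member_input ⟨c, hc⟩]
      split <;> simp)
  rw [solvable_iff, ← algorithm_iff_exists_isPlan] at h₂
  change ForProgram.main.exec (initial I.encode) 1 0 ≤ 1 at h₁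
  change ForProgram.main.exec (initial I.encode) 1 0 ≠ 0 ↔ _ at h₂
  cases hI : I.algorithm
  · rw [hI] at h₂
    simpa using h₂
  · have := h₂.2 hI
    simp only [Bool.toNat_true]
    omega

theorem computableInPolyTime_algorithm : ComputableInPolyTime encode algorithm := by
  refine computableInPolyTime_of_forProgram ForProgram.main ForProgram.isPoly_main
    (fun I => ?_) (fun I => ?_) exec_main_encode
  · exact (Nat.le_add_right I.m I.n).trans (I.length_encode.trans (length_le_inputSize _))
  · exact (Nat.le_add_left I.n I.m).trans (I.length_encode.trans (length_le_inputSize _))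

end Instance

end CoalitionBribery

/-- The dynamic program answers every instance of Plurality`_t`-CBP with `$`-bribery correctly,
and its answer is computed in polynomial time. -/
theorem mainTheorem1 :
    (∀ I : CoalitionBribery.Instance, I.algorithm = true ↔ I.IsYes) ∧
      CoalitionBribery.ComputableInPolyTime
        CoalitionBribery.Instance.encode CoalitionBribery.Instance.algorithm :=
  ⟨fun I => I.algorithm_iff_exists_isPlan.trans I.isYes_iff_exists_isPlan.symm,
    CoalitionBribery.Instance.computableInPolyTime_algorithm⟩
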